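/- Let $AdS_3=\{x\in\mathbb R^{2,2}: \langle x,x\rangle=-1\}$ with the induced Lorentz metric, and let $M$ be an oriented and time-oriented AdS 3-manifold, i.e. a (Hausdorff) smooth 3-manifold locally modelled on $AdS_3$, with changes of charts in $SO_0(2,2)$. Let $\nabla$ be its Levi-Civita connection, $\times$ the cross product on $TM$ given by the metric and the orientation, and $$D^l_vu=\nabla_vu+u\times v,\qquad D^r_vu=\nabla_vu-u\times v .$$ Let $T^{1,t}M$ be the bundle of future-directed unit time-like vectors. For $\xi\in T(T^{1,t}M)$, $\xi=\dot V(0)$ with $V(t)=(x(t),v(t))$ a smooth curve in $T^{1,t}M$, put $M_l(\xi)=\big\|\tfrac{D^lV}{dt}(0)\big\|^2$ and $M_r(\xi)=\big\|\tfrac{D^rV}{dt}(0)\big\|^2$. Let $G(M)$ be the space of maximal time-like geodesics of $M$, i.e. the quotient of $T^{1,t}M$ by the geodesic flow, and let $m_l,m_r$ be the degenerate metrics on $G(M)$ induced by $M_l,M_r$ (those whose pullbacks to $T^{1,t}M$ are $M_l$ and $M_r$). For an open set $U\subset M$, $G(U)$ is defined in the same way from the AdS manifold $U$. We say that $(G(M),m_l\oplus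 m_r)$ is isometric to an open subset of $\mathbb H^2\times\mathbb H^2$ near $\gamma\in G(M)$ if there is a homeomorphism $e=(e_l,e_r)$ from an open neighbourhood of $\gamma$ in $G(M)$ onto an open subset of $\mathbb H^2\times\mathbb H^2$, whose composition with the projection from $T^{1,t}M$ is smooth, such that $m_l=e_l^*g_{\mathbb H^2}$ and $m_r=e_r^*g_{\mathbb H^2}$; in particular $m_l\oplus m_r=e^*(g_{\mathbb H^2}\oplus g_{\mathbb H^2})$. We say that $(G(M),m_l\oplus m_r)$ is locally isometric to $\mathbb H^2\times\mathbb H^2$ if this holds near every $\gamma\in G(M)$. **Lemma.** 1. Every point of $M$ has an open neighbourhood $U_0$ such that, for every open $U\subset U_0$, $(G(U),m_l\oplus m_r)$ is locally isometric to $\mathbb H^2\times\mathbb H^2$. 2. If $M$ is simply connected, then $(G(M),m_l\oplus m_r)$ is locally isometric to $\mathbb H^2\times\mathbb H^2$. 3. For arbitrary $M$, $(G(M),m_l\oplus m_r)$ is isometric to an open subset of $\mathbb H^2\times\mathbb H^2$ near every $\gamma\in G(M)$ around which $G(M)$ is a manifold, in the following sense: some velocity vector $w\in T^{1,t}M$ of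 $\gamma$ has arbitrarily small open neighbourhoods which every maximal time-like geodesic (viewed as an orbit of the geodesic flow) meets in a connected arc. (Equivalently, near $\gamma$, $G(M)$ is a smooth manifold for which the projection $T^{1,t}M\to G(M)$ is a smooth submersion.) -/

import Mathlib

open Set Filter Topology
open scoped Manifold ContDiff

noncomputable section

namespace AdS

/-! ### The model space: the quadric `⟨X, X⟩ = -1` in `ℝ^{2,2}` -/

/-- `ℝ^{2,2}` as a vector space; the first two coordinates are the negative ones. -/
abbrev E22 : Type := Fin 4 → ℝ

/-- The symmetric bilinear form of signature `(2,2)`. -/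
def form (x y : E22) : ℝ := -(x 0 * y 0) - x 1 * y 1 + x 2 * y 2 + x 3 * y 3

/-- Anti-de Sitter space `AdS₃`. Its tangent space at `X` is `{Y | form X Y = 0}`, with the
Lorentz metric induced by `form`. -/
def quadric : Set E22 := {X | form X X = -1}

/-- The time-like tangent vector field on `AdS₃` which defines its time-orientation. -/
def timeField (X : E22) : E22 := ![-X 1, X 0, 0, 0]

/-- `Y`, tangent to `AdS₃` at `X`, is a future-directed (positive) time-like vector. -/
def IsFuture (X Y : E22) : Prop := form X Y = 0 ∧ form Y Y < 0 ∧ form Y (timeField X) < 0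

/-- The group `SO₀(2,2)` of isometries of `AdS₃` preserving orientation and time-orientation. -/
def SO22 : Set (Matrix (Fin 4) (Fin 4) ℝ) :=
  {A | (∀ x y, form (A.mulVec x) (A.mulVec y) = form x y) ∧ A.det = 1 ∧
    ∀ X ∈ quadric, ∀ Y, IsFuture X Y → IsFuture (A.mulVec X) (A.mulVec Y)}

/-- The cross product on `T_X AdS₃`. The volume form of `T_X AdS₃` is
`(u, v, w) ↦ det (X, u, v, w)`, and `(u × v)^* = *(u^* ∧ v^*)` means that
`⟨u × v, w⟩ = det (X, u, v, w)` for all `w`, see `form_cross`. -/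
def cross (X u v : E22) : E22 := fun i =>
  ![-1, -1, 1, 1] i * (Matrix.of ![X, u, v, Pi.single i 1]).det

theorem form_cross (X u v w : E22) :
    form (cross X u v) w = (Matrix.of ![X, u, v, w]).det := by
  simp [form, cross, Matrix.det_succ_row_zero, Fin.sum_univ_succ, Fin.succAbove,
    Matrix.submatrix_apply, Pi.single_apply]
  ring

/-- Orthogonal projection of `ℝ^{2,2}` onto `T_X AdS₃`, for `X ∈ AdS₃`. -/
def tangentProj (X Z : E22) : E22 := Z + form Z X • X

/-! ### AdS 3-manifolds -/

/-- An AdS structure on a smooth 3-manifold `M` (with orientation and time-orientation): `M` is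
locally modelled on `AdS₃`. Around each point `p` there is a local diffeomorphism `dev p` to
`AdS₃`, defined on the open set `source p`, and the changes of charts are locally restrictions of
elements of `SO₀(2,2)`. The Lorentz metric, the orientation and the time-orientation of `M` are
those for which the maps `dev p` are local isometries preserving both orientations. -/
structure AdSStructure (M : Type*) [TopologicalSpace M]
    [ChartedSpace (EuclideanSpace ℝ (Fin 3)) M] where
  source : M → Set M
  dev : M → M → E22
  isOpen_source : ∀ p, IsOpen (source p)
  mem_source : ∀ p, p ∈ source p
  smooth_dev : ∀ p, ContMDiffOn (𝓡 3) 𝓘(ℝ, E22) ∞ (dev p) (source p)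
  dev_mem : ∀ p, ∀ x ∈ source p, dev p x ∈ quadric
  immersion : ∀ p, ∀ x ∈ source p, Function.Injective (mfderiv (𝓡 3) 𝓘(ℝ, E22) (dev p) x)
  compatible : ∀ p q, ∀ x ∈ source p ∩ source q,
    ∃ A ∈ SO22, ∀ᶠ y in 𝓝 x, dev q y = A.mulVec (dev p y)

section

variable {M : Type*} [TopologicalSpace M] [ChartedSpace (EuclideanSpace ℝ (Fin 3)) M]
  [IsManifold (𝓡 3) ∞ M]

/-- The tangent bundle of `M`. -/
abbrev TM (M : Type*) [TopologicalSpace M] [ChartedSpace (EuclideanSpace ℝ (Fin 3)) M] : Type _ :=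
  TangentBundle (𝓡 3) M

/-- The base point of `(x, v) ∈ TM`, read in the chart around `p`. -/
def pos (S : AdSStructure M) (p : M) (w : TM M) : E22 := S.dev p w.proj

/-- The vector `v` of `(x, v) ∈ TM`, read in the chart around `p`. -/
def vec (S : AdSStructure M) (p : M) (w : TM M) : E22 :=
  mfderiv (𝓡 3) 𝓘(ℝ, E22) (S.dev p) w.proj w.2

/-- `T^{1,t}U` for `U ⊆ M`: future-directed unit time-like vectors based at points of `U`. -/
def unitFuture (S : AdSStructure M) (U : Set M) : Set (TM M) :=
  {w | w.proj ∈ U ∧ form (vec S w.proj w) (vec S w.proj w) = -1 ∧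
    IsFuture (pos S w.proj w) (vec S w.proj w)}

/-! ### Covariant derivatives along curves

`V : ℝ → TM` is a curve `V(t) = (x(t), v(t))`, that is, a vector field along `x(t)`. Tangent
vectors at `x(t)` are represented by their images in `ℝ^{2,2}` under the differential of the
isometric chart around `x(t)`. -/

/-- `∇V/dt` for the Levi-Civita connection: the tangential part of the derivative in `ℝ^{2,2}`. -/
def covDeriv (S : AdSStructure M) (V : ℝ → TM M) (t : ℝ) : E22 :=
  tangentProj (pos S (V t).proj (V t)) (deriv (fun s => vec S (V t).proj (V s)) t)

/-- The cross product `v(t) × x'(t)`. -/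
def crossTerm (S : AdSStructure M) (V : ℝ → TM M) (t : ℝ) : E22 :=
  cross (pos S (V t).proj (V t)) (vec S (V t).proj (V t))
    (deriv (fun s => pos S (V t).proj (V s)) t)

/-- `D^l V/dt`, where `D^l_v u = ∇_v u + u × v`. -/
def covDerivL (S : AdSStructure M) (V : ℝ → TM M) (t : ℝ) : E22 :=
  covDeriv S V t + crossTerm S V t

/-- `D^r V/dt`, where `D^r_v u = ∇_v u - u × v`. -/
def covDerivR (S : AdSStructure M) (V : ℝ → TM M) (t : ℝ) : E22 :=
  covDeriv S V t - crossTerm S V t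

/-- `M_l(ξ) = ‖P^l ξ‖²` for the tangent vector `ξ = V'(t)` of `TM`, since `P^l ξ = D^l V/dt`. -/
def metricL (S : AdSStructure M) (V : ℝ → TM M) (t : ℝ) : ℝ :=
  form (covDerivL S V t) (covDerivL S V t)

/-- `M_r(ξ) = ‖P^r ξ‖²` for the tangent vector `ξ = V'(t)` of `TM`, since `P^r ξ = D^r V/dt`. -/
def metricR (S : AdSStructure M) (V : ℝ → TM M) (t : ℝ) : ℝ :=
  form (covDerivR S V t) (covDerivR S V t)

/-! ### The space of maximal time-like geodesics -/

/-- The velocity curve of a curve in `M`, as a curve in `TM`. -/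
def velocity (c : ℝ → M) (t : ℝ) : TM M := ⟨c t, mfderiv 𝓘(ℝ, ℝ) (𝓡 3) c t (1 : ℝ)⟩

/-- `c` is a geodesic of `M` on the open set `J` of times. -/
def IsGeodesicOn (S : AdSStructure M) (c : ℝ → M) (J : Set ℝ) : Prop :=
  ContMDiffOn 𝓘(ℝ, ℝ) (𝓡 3) ∞ c J ∧ ∀ t ∈ J, covDeriv S (velocity c) t = 0

/-- `v` and `w` are velocities of one geodesic, defined on an open interval, all of whose
velocities lie in `N`. -/
def Joined (S : AdSStructure M) (N : Set (TM M)) (v w : TM M) : Prop :=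
  ∃ (c : ℝ → M) (J : Set ℝ), IsOpen J ∧ J.OrdConnected ∧ IsGeodesicOn S c J ∧
    (∀ t ∈ J, velocity c t ∈ N) ∧ ∃ s ∈ J, ∃ t ∈ J, velocity c s = v ∧ velocity c t = w

/-- `G(U)`: the space of maximal time-like geodesics of the open subset `U` of `M` (`G(M)` is the
case `U = univ`). A maximal time-like geodesic, with its future-directed unit speed
parametrization up to translation of time, is an orbit of the geodesic flow on `T^{1,t}U`, so that
`G(U)` is the quotient of `T^{1,t}U` by the geodesic flow, with the quotient topology. -/
def GeodesicSpace (S : AdSStructure M) (U : Set M) : Type _ :=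
  Quot (fun v w : unitFuture S U => Joined S (unitFuture S U) v w)

instance (S : AdSStructure M) (U : Set M) : TopologicalSpace (GeodesicSpace S U) :=
  inferInstanceAs (TopologicalSpace (Quot _))

/-- The maximal geodesic of `U` with a given velocity: the projection `T^{1,t}U → G(U)`. -/
def toGeodesic (S : AdSStructure M) (U : Set M) (w : unitFuture S U) : GeodesicSpace S U :=
  Quot.mk _ w

/-- Near `w`, the geodesic flow of `T^{1,t}M` has no return: `w` has arbitrarily small open
neighbourhoods which every maximal time-like geodesic meets in a connected arc. (Equivalently,
near the geodesic of `w`, `G(M)` is a smooth manifold for which `T^{1,t}M → G(M)` is a smooth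
submersion.) -/
def NoReturnAt (S : AdSStructure M) (w : TM M) : Prop :=
  ∀ W : Set (TM M), IsOpen W → w ∈ W → ∃ N ⊆ W, IsOpen N ∧ w ∈ N ∧
    ∀ v ∈ N ∩ unitFuture S univ, ∀ v' ∈ N ∩ unitFuture S univ,
      Joined S (unitFuture S univ) v v' → Joined S (N ∩ unitFuture S univ) v v'

/-! ### The hyperbolic plane and local isometries -/

/-- Minkowski space `ℝ^{2,1}`; the coordinate `0` is the negative one. -/
abbrev E21 : Type := Fin 3 → ℝ

/-- The Minkowski form. -/
def mink (x y : E21) : ℝ := -(x 0 * y 0) + x 1 * y 1 + x 2 * y 2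

/-- The hyperbolic plane (hyperboloid model), with the Riemannian metric induced by `mink`. -/
def HypPlane : Type := {z : E21 // mink z z = -1 ∧ 0 < z 0}

instance : TopologicalSpace HypPlane := inferInstanceAs (TopologicalSpace {z : E21 // mink z z = -1 ∧ 0 < z 0})

/-- The squared hyperbolic norm of the velocity at time `t` of a curve in the hyperbolic plane. -/
def speedSq (z : ℝ → HypPlane) (t : ℝ) : ℝ :=
  mink (deriv (fun s => (z s).1) t) (deriv (fun s => (z s).1) t)

/-- The composition of a map `e : G(U) → ℍ² × ℍ²` with the projection from `T^{1,t}U`, as a map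
on `TM` with values in `ℝ^{2,1} × ℝ^{2,1}` (extended by `0` outside `T^{1,t}U`). -/
def liftMap (S : AdSStructure M) (U : Set M) (e : GeodesicSpace S U → HypPlane × HypPlane) :
    TM M → E21 × E21 :=
  Function.extend (Subtype.val : unitFuture S U → TM M)
    (fun w => ((e (toGeodesic S U w)).1.1, (e (toGeodesic S U w)).2.1)) 0

/-- `(G(U), m_l ⊕ m_r)` is isometric to an open subset of `ℍ² × ℍ²` near the geodesic `γ`: a
neighbourhood of `γ` is mapped homeomorphically by some `e` onto an open subset of `ℍ² × ℍ²`; `e`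
is smooth (its composition with the projection from `T^{1,t}U` is smooth), and `m_l`, `m_r` are
the pullbacks by `e` of the metrics of the two factors. As `m_l` and `m_r` are the metrics whose
pullbacks to `T^{1,t}U` are `M_l` and `M_r`, the latter is an equality between quadratic forms on
the tangent vectors `ξ = V'(t)` of `T^{1,t}U`. -/
def LocallyIsometricAt (S : AdSStructure M) (U : Set M) (γ : GeodesicSpace S U) : Prop :=
  ∃ e : OpenPartialHomeomorph (GeodesicSpace S U) (HypPlane × HypPlane), γ ∈ e.source ∧
    ContMDiffOn (𝓡 3).tangent 𝓘(ℝ, E21 × E21) ∞ (liftMap S U e)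
      (Subtype.val '' (toGeodesic S U ⁻¹' e.source)) ∧
    ∀ (V : ℝ → unitFuture S U) (t : ℝ),
      ContMDiffAt 𝓘(ℝ, ℝ) (𝓡 3).tangent ∞ (fun s => (V s : TM M)) t →
      toGeodesic S U (V t) ∈ e.source →
      metricL S (fun s => (V s : TM M)) t =
          speedSq (fun s => (e (toGeodesic S U (V s))).1) t ∧
        metricR S (fun s => (V s : TM M)) t =
          speedSq (fun s => (e (toGeodesic S U (V s))).2) t

end

end AdS

end

/-!
A unit time-like vector `(X, Y)` of the quadric spans a negative plane of `ℝ^{2,2}`, and its orbit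
under the geodesic flow consists of the positively oriented orthonormal bases of that plane. Hence a
time-like geodesic of `AdS₃` is the same as the bivector `X ∧ Y`. The decomposition of
`Λ² ℝ^{2,2}` into its self-dual and anti-self-dual parts, which are two copies of `ℝ^{2,1}`, turns
it into a pair of points of `ℍ² × ℍ²`: this is the map `psi`. It separates geodesics
(`rotate_of_psi_eq`), it has local sections (`isUnitFuture_section`), and the squared speeds of its
two components along a curve of time-like vectors are `M_l` and `M_r` (`form_covDerivL_eq`,
`form_covDerivR_eq`): both are a sum of Gram terms and of twice a determinant, whose sign is the one
of the cross product term in `D^l` and `D^r`.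

In an AdS manifold, `psi` is computed in a local developing map (`IsLocalDev`), which is determined
up to `SO₀(2,2)`. If near a vector `w` the value of `psi` in one chart only depends on the geodesic
in `G(U)`, then it is a local isometric coordinate system on `G(U)`
(`locallyIsometricAt_of_psi`). It is injective in a flow box, and open by the local section. Its
openness and smoothness on the whole saturation of a neighbourhood of `w`, which may leave the
chart, come from `HoldsNear.of_joined`: along a geodesic, the developing map can be continued, and
the geodesic flow transports the description of the coordinates by `psi` to the continuation.

The hypothesis of `locallyIsometricAt_of_psi` holds in the three cases since `psi` is constant along
geodesics, as long as one developing map is defined along them (`psi_eq_of_joined`). Over the domain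
of a chart this is clear. A simply connected manifold has a global developing map
(`exists_isLocalDev`): germs of developing maps form a covering, through which the identity lifts.
In the absence of return, two vectors near `w` on one geodesic are joined by an arc that stays
near `w`; here one needs that being joined is an equivalence relation, i.e. that geodesics can
be glued (`Joined.trans`).
-/

open Set Filter Topology
open scoped Manifold ContDiff

noncomputable section

namespace AdS

/-! ### The bivector of a time-like geodesic of the model -/

theorem form_comm (x y : E22) : form x y = form y x := by simp only [form]; ring

theorem form_add_left (x y z : E22) : form (x + y) z = form x z + form y z := by
  simp only [form, Pi.add_apply]; ring

theorem form_add_right (x y z : E22) : form x (y + z) = form x y + form x z := by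
  simp only [form, Pi.add_apply]; ring

theorem form_smul_left (a : ℝ) (x y : E22) : form (a • x) y = a * form x y := by
  simp only [form, Pi.smul_apply, smul_eq_mul]; ring

theorem form_smul_right (a : ℝ) (x y : E22) : form x (a • y) = a * form x y := by
  simp only [form, Pi.smul_apply, smul_eq_mul]; ring

/-- `Y` is a future-directed unit time-like tangent vector of `AdS₃` at the point `X`. -/
def IsUnitFuture (X Y : E22) : Prop :=
  form X X = -1 ∧ form X Y = 0 ∧ form Y Y = -1 ∧ form Y (timeField X) < 0

/-- The self-dual part of the bivector `X ∧ Y`. -/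
def psiL (x y : E22) : E21 :=
  ![x 0 * y 1 - x 1 * y 0 + (x 2 * y 3 - x 3 * y 2),
    x 0 * y 2 - x 2 * y 0 + (x 1 * y 3 - x 3 * y 1),
    x 0 * y 3 - x 3 * y 0 - (x 1 * y 2 - x 2 * y 1)]

/-- The anti-self-dual part of the bivector `X ∧ Y`. -/
def psiR (x y : E22) : E21 :=
  ![x 0 * y 1 - x 1 * y 0 - (x 2 * y 3 - x 3 * y 2),
    x 0 * y 2 - x 2 * y 0 - (x 1 * y 3 - x 3 * y 1),
    x 0 * y 3 - x 3 * y 0 + (x 1 * y 2 - x 2 * y 1)]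

/-- The bivector `x ∧ y`, decomposed into its self-dual and anti-self-dual parts. On unit
time-like tangent vectors of `AdS₃` it is a complete invariant of the geodesic. -/
def psi (x y : E22) : E21 × E21 := (psiL x y, psiR x y)

theorem mink_psiL (x y : E22) :
    mink (psiL x y) (psiL x y) = form x y ^ 2 - form x x * form y y := by
  simp [mink, psiL, form]; ring

theorem mink_psiR (x y : E22) :
    mink (psiR x y) (psiR x y) = form x y ^ 2 - form x x * form y y := by
  simp [mink, psiR, form]; ring

/-- The Lagrange identity behind the positivity of the time coordinates of `psiL` and `psiR`. -/
theorem abs_lt_of_isUnitFuture {X Y : E22} (h : IsUnitFuture X Y) :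
    |X 2 * Y 3 - X 3 * Y 2| < X 0 * Y 1 - X 1 * Y 0 := by
  obtain ⟨h1, h2, h3, h4⟩ := h
  simp [form, timeField] at h1 h2 h3 h4
  refine abs_lt_of_sq_lt_sq ?_ (by linarith)
  have e : (X 0 * Y 1 - X 1 * Y 0) ^ 2 =
      (X 0 ^ 2 + X 1 ^ 2) * (Y 0 ^ 2 + Y 1 ^ 2) - (X 0 * Y 0 + X 1 * Y 1) ^ 2 := by ring
  have e1 : X 0 ^ 2 + X 1 ^ 2 = 1 + X 2 ^ 2 + X 3 ^ 2 := by linarith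
  have e2 : Y 0 ^ 2 + Y 1 ^ 2 = 1 + Y 2 ^ 2 + Y 3 ^ 2 := by linarith
  have e3 : X 0 * Y 0 + X 1 * Y 1 = X 2 * Y 2 + X 3 * Y 3 := by linarith
  rw [e, e1, e2, e3]
  nlinarith [sq_nonneg (X 2), sq_nonneg (X 3), sq_nonneg (Y 2), sq_nonneg (Y 3)]

theorem psiL_mem {X Y : E22} (h : IsUnitFuture X Y) :
    mink (psiL X Y) (psiL X Y) = -1 ∧ 0 < psiL X Y 0 := by
  refine ⟨by rw [mink_psiL, h.1, h.2.1, h.2.2.1]; norm_num, ?_⟩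
  have := (abs_lt.1 (abs_lt_of_isUnitFuture h)).1
  simp only [psiL, Matrix.cons_val_zero]; linarith

theorem psiR_mem {X Y : E22} (h : IsUnitFuture X Y) :
    mink (psiR X Y) (psiR X Y) = -1 ∧ 0 < psiR X Y 0 := by
  refine ⟨by rw [mink_psiR, h.1, h.2.1, h.2.2.1]; norm_num, ?_⟩
  have := (abs_lt.1 (abs_lt_of_isUnitFuture h)).2
  simp only [psiR, Matrix.cons_val_zero]; linarith

/-- The bivector `X ∧ Y` only depends on the orbit of `(X, Y)` under the geodesic flow. -/
theorem psi_rotate (X Y : E22) {a b : ℝ} (h : a ^ 2 + b ^ 2 = 1) :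
    psi (a • X + b • Y) (-(b • X) + a • Y) = psi X Y := by
  have e : ∀ i j, (a • X + b • Y) i * (-(b • X) + a • Y) j -
      (a • X + b • Y) j * (-(b • X) + a • Y) i = X i * Y j - X j * Y i := by
    intro i j
    simp only [Pi.add_apply, Pi.smul_apply, Pi.neg_apply, smul_eq_mul]
    linear_combination (X i * Y j - X j * Y i) * h
  simp only [psi, psiL, psiR, e]

/-- Two unit time-like vectors with the same invariant `psi` span one plane, hence are velocities of
one geodesic of `AdS₃`: they differ by the rotation of angle `θ`, where `cos θ = -⟨Y, Y'⟩` and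
`sin θ = ⟨X, Y'⟩`. -/
theorem rotate_of_psi_eq {X Y X' Y' : E22} (h : IsUnitFuture X Y) (h' : IsUnitFuture X' Y')
    (e : psi X Y = psi X' Y') :
    form Y Y' ^ 2 + form X Y' ^ 2 = 1 ∧ X' = (-form Y Y') • X + form X Y' • Y ∧
      Y' = -(form X Y' • X) + (-form Y Y') • Y := by
  have p : ∀ i j, X i * Y j - X j * Y i = X' i * Y' j - X' j * Y' i := by
    simp only [psi, psiL, psiR, Prod.mk.injEq] at e
    obtain ⟨e1, e2⟩ := e
    have a0 := congrFun e1 0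
    have a1 := congrFun e1 1
    have a2 := congrFun e1 2
    have b0 := congrFun e2 0
    have b1 := congrFun e2 1
    have b2 := congrFun e2 2
    simp at a0 a1 a2 b0 b1 b2
    intro i j
    fin_cases i <;> fin_cases j <;> simp <;> linarith
  -- contraction of the two bivectors with a vector
  have c : ∀ Z : E22, form Y Z • X - form X Z • Y = form Y' Z • X' - form X' Z • Y' := by
    intro Z
    ext i
    simp only [Pi.sub_apply, Pi.smul_apply, smul_eq_mul, form]
    linear_combination -(p i 0) * Z 0 - (p i 1) * Z 1 + p i 2 * Z 2 + p i 3 * Z 3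
  obtain ⟨h1, h2, h3, -⟩ := h
  obtain ⟨h1', h2', h3', -⟩ := h'
  have hX' : X' = (-form Y Y') • X + form X Y' • Y := by
    have := c Y'
    rw [h2', h3'] at this
    have t : X' = -((-1 : ℝ) • X' - (0 : ℝ) • Y') := by simp
    rw [t, ← this]; module
  have hY' : Y' = form Y X' • X - form X X' • Y := by
    have := c X'
    rw [form_comm Y' X', h2', h1'] at this
    rw [this]; module
  have a1 : form Y X' = -form X Y' := by
    conv_lhs => rw [hX']
    rw [form_add_right, form_smul_right, form_smul_right, h3, form_comm Y X, h2]; ring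
  have a2 : form X X' = form Y Y' := by
    conv_lhs => rw [hX']
    rw [form_add_right, form_smul_right, form_smul_right, h1, h2]; ring
  refine ⟨?_, hX', ?_⟩
  · have := h1'
    conv_lhs at this => rw [hX']
    simp only [form_add_right, form_smul_right, form_add_left, form_smul_left, h3,
      form_comm Y X, h2, h1] at this
    linarith
  · conv_lhs => rw [hY', a1, a2]
    module

/-! ### A local section of the invariants -/

/-- The endomorphism given by a self-dual bivector: if `z = psiL X Y` for a unit time-like vector
`(X, Y)`, then `Y = mulL z X`. -/
def mulL (z : E21) (X : E22) : E22 :=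
  ![-z 0 * X 1 + z 1 * X 2 + z 2 * X 3, z 0 * X 0 - z 2 * X 2 + z 1 * X 3,
    z 1 * X 0 - z 2 * X 1 + z 0 * X 3, z 2 * X 0 + z 1 * X 1 - z 0 * X 2]

/-- The endomorphism given by an anti-self-dual bivector: if `z = psiR X Y` for a unit time-like
vector `(X, Y)`, then `Y = mulR z X`. -/
def mulR (z : E21) (X : E22) : E22 :=
  ![-z 0 * X 1 + z 1 * X 2 + z 2 * X 3, z 0 * X 0 + z 2 * X 2 - z 1 * X 3,
    z 1 * X 0 + z 2 * X 1 - z 0 * X 3, z 2 * X 0 - z 1 * X 1 + z 0 * X 2]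

theorem mulL_mulL (z : E21) (X : E22) : mulL z (mulL z X) = mink z z • X := by
  ext i; fin_cases i <;> simp [mulL, mink] <;> ring

theorem mulR_mulR (z : E21) (X : E22) : mulR z (mulR z X) = mink z z • X := by
  ext i; fin_cases i <;> simp [mulR, mink] <;> ring

theorem mulL_mulR (z z' : E21) (X : E22) : mulL z (mulR z' X) = mulR z' (mulL z X) := by
  ext i; fin_cases i <;> simp [mulL, mulR] <;> ring

theorem mulL_smul (z : E21) (a : ℝ) (X : E22) : mulL z (a • X) = a • mulL z X := by
  ext i; fin_cases i <;> simp [mulL] <;> ring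

theorem mulR_smul (z : E21) (a : ℝ) (X : E22) : mulR z (a • X) = a • mulR z X := by
  ext i; fin_cases i <;> simp [mulR] <;> ring

theorem mulL_sub (z : E21) (X Y : E22) : mulL z (X - Y) = mulL z X - mulL z Y := by
  ext i; fin_cases i <;> simp [mulL] <;> ring

theorem mulR_sub (z : E21) (X Y : E22) : mulR z (X - Y) = mulR z X - mulR z Y := by
  ext i; fin_cases i <;> simp [mulR] <;> ring

theorem form_mulL (z : E21) (X : E22) : form (mulL z X) (mulL z X) = -(mink z z) * form X X := by
  simp [mulL, mink, form]; ring

theorem form_self_mulL (z : E21) (X : E22) : form X (mulL z X) = 0 := by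
  simp [mulL, form]; ring

theorem psiL_mulL (z : E21) (X : E22) : psiL X (mulL z X) = -(form X X) • z := by
  ext i; fin_cases i <;> simp [mulL, psiL, form] <;> ring

theorem psiR_mulR (z : E21) (X : E22) : psiR X (mulR z X) = -(form X X) • z := by
  ext i; fin_cases i <;> simp [mulR, psiR, form] <;> ring

theorem mulL_psiL (X Y : E22) : mulL (psiL X Y) X = -(form X X) • Y + form X Y • X := by
  ext i; fin_cases i <;> simp [mulL, psiL, form] <;> ring

theorem mulR_psiR (X Y : E22) : mulR (psiR X Y) X = -(form X X) • Y + form X Y • X := by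
  ext i; fin_cases i <;> simp [mulR, psiR, form] <;> ring

/-- The geodesic of `AdS₃` with invariants `z = (z_l, z_r)` lies in the plane
`{X | mulL z_l X = mulR z_r X}`, and this map gives twice the projection of `X₀` onto that plane. -/
def planeProj (X₀ : E22) (z : E21 × E21) : E22 := X₀ - mulL z.1 (mulR z.2 X₀)

/-- A local section of `psi`: a point of the geodesic with invariants `z`, close to `X₀`. -/
def sectionPt (X₀ : E22) (z : E21 × E21) : E22 :=
  (Real.sqrt (-form (planeProj X₀ z) (planeProj X₀ z)))⁻¹ • planeProj X₀ z

theorem continuous_form : Continuous fun p : E22 × E22 => form p.1 p.2 := by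
  unfold form; fun_prop

theorem continuous_mulL : Continuous fun p : E21 × E22 => mulL p.1 p.2 := by
  refine continuous_pi fun i => ?_
  fin_cases i <;> simp [mulL] <;> fun_prop

theorem continuous_mulR : Continuous fun p : E21 × E22 => mulR p.1 p.2 := by
  refine continuous_pi fun i => ?_
  fin_cases i <;> simp [mulR] <;> fun_prop

theorem continuous_planeProj (X₀ : E22) : Continuous (planeProj X₀) :=
  continuous_const.sub (continuous_mulL.comp (continuous_fst.prodMk
    (continuous_mulR.comp (continuous_snd.prodMk continuous_const))))

theorem planeProj_psi {X Y : E22} (h : IsUnitFuture X Y) : planeProj X (psi X Y) = (2 : ℝ) • X := by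
  have e1 : mulR (psi X Y).2 X = mulL (psi X Y).1 X := by
    simp [psi, mulL_psiL, mulR_psiR]
  rw [planeProj, e1, mulL_mulL]
  simp only [psi, (psiL_mem h).1]; module

theorem sectionPt_psi {X Y : E22} (h : IsUnitFuture X Y) : sectionPt X (psi X Y) = X := by
  rw [sectionPt, planeProj_psi h, form_smul_left, form_smul_right, h.1,
    show -(2 * (2 * (-1 : ℝ))) = 2 ^ 2 by norm_num, Real.sqrt_sq (by norm_num), smul_smul]
  norm_num

theorem continuousAt_sectionPt {X Y : E22} (h : IsUnitFuture X Y) :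
    ContinuousAt (sectionPt X) (psi X Y) := by
  have hc := continuous_planeProj X
  have hf : Continuous fun z => form (planeProj X z) (planeProj X z) :=
    continuous_form.comp (hc.prodMk hc)
  refine ContinuousAt.smul (ContinuousAt.inv₀ (Real.continuous_sqrt.comp hf.neg).continuousAt ?_)
    hc.continuousAt
  change Real.sqrt (-form (planeProj X (psi X Y)) (planeProj X (psi X Y))) ≠ 0
  rw [planeProj_psi h, form_smul_left, form_smul_right, h.1]
  norm_num

/-- Near `psi X Y`, the vector `mulL z.1 (sectionPt X z)` at the point `sectionPt X z` is a unit
time-like vector with the invariants `z`. -/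
theorem isUnitFuture_section {X Y : E22} (h : IsUnitFuture X Y) :
    ∀ᶠ z in 𝓝 (psi X Y), mink z.1 z.1 = -1 → mink z.2 z.2 = -1 →
      IsUnitFuture (sectionPt X z) (mulL z.1 (sectionPt X z)) ∧
      psi (sectionPt X z) (mulL z.1 (sectionPt X z)) = z := by
  have hc := continuous_planeProj X
  have hf : Continuous fun z => form (planeProj X z) (planeProj X z) :=
    continuous_form.comp (hc.prodMk hc)
  have hneg : ∀ᶠ z in 𝓝 (psi X Y), form (planeProj X z) (planeProj X z) < 0 := by
    refine hf.continuousAt.eventually_lt_const ?_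
    beta_reduce
    rw [planeProj_psi h, form_smul_left, form_smul_right, h.1]
    norm_num
  have hfut : ∀ᶠ z in 𝓝 (psi X Y), form (mulL z.1 (sectionPt X z)) (timeField (sectionPt X z)) < 0 := by
    have ct : Continuous timeField := by
      refine continuous_pi fun i => ?_
      fin_cases i <;> simp [timeField] <;> fun_prop
    have cs := continuousAt_sectionPt h
    have : ContinuousAt (fun z : E21 × E21 =>
        form (mulL z.1 (sectionPt X z)) (timeField (sectionPt X z))) (psi X Y) :=
      continuous_form.continuousAt.comp
        ((continuous_mulL.continuousAt.comp (continuousAt_fst.prodMk cs)).prodMk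
          (ct.continuousAt.comp cs))
    refine this.eventually_lt_const ?_
    beta_reduce
    rw [sectionPt_psi h, psi, mulL_psiL, h.1, h.2.1]
    simpa using h.2.2.2
  filter_upwards [hneg, hfut] with z hz hz' m1 m2
  have n : form (sectionPt X z) (sectionPt X z) = -1 := by
    rw [sectionPt, form_smul_left, form_smul_right]
    have hs : 0 < Real.sqrt (-form (planeProj X z) (planeProj X z)) :=
      Real.sqrt_pos.2 (by linarith)
    have hs2 := Real.sq_sqrt (show 0 ≤ -form (planeProj X z) (planeProj X z) by linarith)
    field_simp
    linarith
  have hLR : mulL z.1 (sectionPt X z) = mulR z.2 (sectionPt X z) := by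
    rw [sectionPt, mulL_smul, mulR_smul]
    congr 1
    rw [planeProj, mulL_sub, mulR_sub, mulL_mulL, m1, mulL_mulR, mulR_mulR, m2]
    module
  refine ⟨⟨n, form_self_mulL _ _, by rw [form_mulL, m1, n]; norm_num, hz'⟩, ?_⟩
  refine Prod.ext ?_ ?_
  · simp [psi, psiL_mulL, n]
  · simp only [psi]
    rw [hLR, psiR_mulR, n]; simp

/-! ### The left and right metrics in terms of the invariants -/

theorem psi_self (x : E22) : psi x x = 0 := by
  refine Prod.ext ?_ ?_ <;> ext i <;> fin_cases i <;> simp [psi, psiL, psiR] <;> ring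

/-- `psi` as a continuous bilinear map. -/
def psiCLM : E22 →L[ℝ] E22 →L[ℝ] E21 × E21 :=
  LinearMap.toContinuousLinearMap
    (LinearMap.toContinuousLinearMap.toLinearMap.comp
    (LinearMap.mk₂ ℝ psi
      (by intros; refine Prod.ext ?_ ?_ <;> ext i <;> fin_cases i <;> simp [psi, psiL, psiR] <;> ring)
      (by intros; refine Prod.ext ?_ ?_ <;> ext i <;> fin_cases i <;> simp [psi, psiL, psiR] <;> ring)
      (by intros; refine Prod.ext ?_ ?_ <;> ext i <;> fin_cases i <;> simp [psi, psiL, psiR] <;> ring)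
      (by intros; refine Prod.ext ?_ ?_ <;> ext i <;> fin_cases i <;> simp [psi, psiL, psiR] <;> ring)))

theorem psiCLM_apply (x y : E22) : psiCLM x y = psi x y := rfl

theorem det_four (x y a b : E22) : (Matrix.of ![x, y, a, b]).det =
    (x 0 * y 1 - x 1 * y 0) * (a 2 * b 3 - a 3 * b 2)
    - (x 0 * y 2 - x 2 * y 0) * (a 1 * b 3 - a 3 * b 1)
    + (x 0 * y 3 - x 3 * y 0) * (a 1 * b 2 - a 2 * b 1)
    + (x 1 * y 2 - x 2 * y 1) * (a 0 * b 3 - a 3 * b 0)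
    - (x 1 * y 3 - x 3 * y 1) * (a 0 * b 2 - a 2 * b 0)
    + (x 2 * y 3 - x 3 * y 2) * (a 0 * b 1 - a 1 * b 0) := by
  simp [Matrix.det_succ_row_zero, Fin.sum_univ_succ, Fin.succAbove, Matrix.submatrix_apply]
  ring

/-- The norm of `cross x y a` is the Gram determinant of `x, y, a`: the signature has two minus
signs. -/
theorem form_cross_cross (x y a : E22) : form (cross x y a) (cross x y a) =
    form x x * (form y y * form a a - form y a ^ 2) - form x y * (form x y * form a a -
      form y a * form x a) + form x a * (form x y * form y a - form y y * form x a) := by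
  have c0 : cross x y a 0 = -(Matrix.of ![x, y, a, Pi.single 0 1]).det := by simp [cross]
  have c1 : cross x y a 1 = -(Matrix.of ![x, y, a, Pi.single 1 1]).det := by simp [cross]
  have c2 : cross x y a 2 = (Matrix.of ![x, y, a, Pi.single 2 1]).det := by simp [cross]
  have c3 : cross x y a 3 = (Matrix.of ![x, y, a, Pi.single 3 1]).det := by simp [cross]
  rw [det_four] at c0 c1 c2 c3
  simp at c0 c1 c2 c3
  simp only [form, c0, c1, c2, c3]
  ring

/-- The norm of the self-dual part of `a ∧ y + x ∧ b`, the derivative of `x ∧ y` when `x' = a` and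
`y' = b`. The determinant enters with the opposite sign for the anti-self-dual part. -/
theorem mink_psiL_add (x y a b : E22) :
    mink (psiL a y + psiL x b) (psiL a y + psiL x b) =
      form a y ^ 2 - form a a * form y y + (form x b ^ 2 - form x x * form b b)
      - 2 * (form a x * form y b - form a b * form x y) + 2 * (Matrix.of ![x, y, a, b]).det := by
  rw [det_four]
  simp [mink, psiL, form]
  ring

theorem mink_psiR_add (x y a b : E22) :
    mink (psiR a y + psiR x b) (psiR a y + psiR x b) =
      form a y ^ 2 - form a a * form y y + (form x b ^ 2 - form x x * form b b)
      - 2 * (form a x * form y b - form a b * form x y) - 2 * (Matrix.of ![x, y, a, b]).det := by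
  rw [det_four]
  simp [mink, psiR, form]
  ring

/-- The norm of `D^l V/dt` (`s = 1`) and of `D^r V/dt` (`s = -1`) for `V = (x, y)`, `x' = a`,
`y' = b`. -/
theorem form_tangentProj_add_cross {x y a b : E22} (hxx : form x x = -1) (hxy : form x y = 0)
    (hyy : form y y = -1) (hxa : form x a = 0)
    (hk : form x b = -form y a) (s : ℝ) (hs : s ^ 2 = 1) :
    form (tangentProj x b + s • cross x y a) (tangentProj x b + s • cross x y a) =
      form a a + form b b + 2 * form y a ^ 2 + 2 * s * (Matrix.of ![x, y, a, b]).det := by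
  have e1 : form (cross x y a) x = 0 := by rw [form_cross, det_four]; ring
  have e2 := form_cross x y a b
  have e3 := form_cross_cross x y a
  rw [hxx, hxy, hyy, hxa] at e3
  simp only [tangentProj, form_add_left, form_add_right, form_smul_left, form_smul_right, e1, e2,
    form_comm x (cross x y a), form_comm b (cross x y a), form_comm b x, hk, hxx]
  linear_combination s ^ 2 * e3 + (form a a + form y a ^ 2) * hs

theorem form_covDerivL_eq {x y a b : E22} (hxx : form x x = -1) (hxy : form x y = 0)
    (hyy : form y y = -1) (hxa : form x a = 0) (hyb : form y b = 0)
    (hk : form x b = -form y a) :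
    form (tangentProj x b + cross x y a) (tangentProj x b + cross x y a) =
      mink (psiL a y + psiL x b) (psiL a y + psiL x b) := by
  have := form_tangentProj_add_cross hxx hxy hyy hxa hk 1 (by norm_num)
  rw [one_smul] at this
  rw [this, mink_psiL_add, hk, hxx, hxy, hyy, hyb, form_comm a y]
  ring

theorem form_covDerivR_eq {x y a b : E22} (hxx : form x x = -1) (hxy : form x y = 0)
    (hyy : form y y = -1) (hxa : form x a = 0) (hyb : form y b = 0)
    (hk : form x b = -form y a) :
    form (tangentProj x b - cross x y a) (tangentProj x b - cross x y a) =
      mink (psiR a y + psiR x b) (psiR a y + psiR x b) := by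
  have := form_tangentProj_add_cross hxx hxy hyy hxa hk (-1) (by norm_num)
  rw [neg_one_smul, ← sub_eq_add_neg] at this
  rw [this, mink_psiR_add, hk, hxx, hxy, hyy, hyb, form_comm a y]
  ring

/-! ### The isometry group of the model -/

theorem one_mem_SO22 : (1 : Matrix (Fin 4) (Fin 4) ℝ) ∈ SO22 := by
  refine ⟨?_, Matrix.det_one, ?_⟩ <;> simp

theorem mul_mem_SO22 {A B : Matrix (Fin 4) (Fin 4) ℝ} (hA : A ∈ SO22) (hB : B ∈ SO22) :
    A * B ∈ SO22 := by
  obtain ⟨a1, a2, a3⟩ := hA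
  obtain ⟨b1, b2, b3⟩ := hB
  refine ⟨fun x y => by rw [← Matrix.mulVec_mulVec, ← Matrix.mulVec_mulVec, a1, b1],
    by rw [Matrix.det_mul, a2, b2, one_mul], fun X hX Y h => ?_⟩
  rw [← Matrix.mulVec_mulVec, ← Matrix.mulVec_mulVec]
  exact a3 _ (by rw [quadric, mem_ofPred_eq, b1]; exact hX) _ (b3 X hX Y h)

theorem isUnitFuture_iff {X Y : E22} (hX : X ∈ quadric) :
    IsUnitFuture X Y ↔ form Y Y = -1 ∧ IsFuture X Y := by
  constructor
  · rintro ⟨h1, h2, h3, h4⟩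
    exact ⟨h3, h2, by rw [h3]; norm_num, h4⟩
  · rintro ⟨h1, h2, h3, h4⟩
    exact ⟨hX, h2, h1, h4⟩

theorem IsUnitFuture.mulVec {A : Matrix (Fin 4) (Fin 4) ℝ} (hA : A ∈ SO22) {X Y : E22}
    (h : IsUnitFuture X Y) : IsUnitFuture (A.mulVec X) (A.mulVec Y) := by
  have hX : X ∈ quadric := h.1
  have hX' : A.mulVec X ∈ quadric := by rw [quadric, mem_ofPred_eq, hA.1]; exact h.1
  rw [isUnitFuture_iff hX'] at *
  rw [isUnitFuture_iff hX] at h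
  exact ⟨by rw [hA.1, h.1], hA.2.2 X hX Y h.2⟩

theorem mulVec_injective_of_mem_SO22 {A : Matrix (Fin 4) (Fin 4) ℝ} (hA : A ∈ SO22) :
    Function.Injective A.mulVec :=
  Matrix.mulVec_injective_of_isUnit
    ((Matrix.isUnit_iff_isUnit_det A).2 (by rw [hA.2.1]; exact isUnit_one))

theorem det_mulVec {A : Matrix (Fin 4) (Fin 4) ℝ} (hA : A.det = 1) (x y a b : E22) :
    (Matrix.of ![A.mulVec x, A.mulVec y, A.mulVec a, A.mulVec b]).det =
      (Matrix.of ![x, y, a, b]).det := by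
  have : Matrix.of ![A.mulVec x, A.mulVec y, A.mulVec a, A.mulVec b] =
      Matrix.of ![x, y, a, b] * A.transpose := by
    ext i j
    fin_cases i <;> simp [Matrix.mul_apply, Matrix.mulVec, dotProduct, mul_comm]
  rw [this, Matrix.det_mul, Matrix.det_transpose, hA, mul_one]

theorem mink_psiL_add_mulVec {A : Matrix (Fin 4) (Fin 4) ℝ} (hA : A ∈ SO22) (x y a b : E22) :
    mink (psiL (A.mulVec a) (A.mulVec y) + psiL (A.mulVec x) (A.mulVec b))
      (psiL (A.mulVec a) (A.mulVec y) + psiL (A.mulVec x) (A.mulVec b)) =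
    mink (psiL a y + psiL x b) (psiL a y + psiL x b) := by
  simp only [mink_psiL_add, det_mulVec hA.2.1, hA.1]

theorem mink_psiR_add_mulVec {A : Matrix (Fin 4) (Fin 4) ℝ} (hA : A ∈ SO22) (x y a b : E22) :
    mink (psiR (A.mulVec a) (A.mulVec y) + psiR (A.mulVec x) (A.mulVec b))
      (psiR (A.mulVec a) (A.mulVec y) + psiR (A.mulVec x) (A.mulVec b)) =
    mink (psiR a y + psiR x b) (psiR a y + psiR x b) := by
  simp only [mink_psiR_add, det_mulVec hA.2.1, hA.1]

/-- Having the same invariants is a property of pairs of unit time-like vectors that is reflected by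
isometries. -/
theorem psi_eq_of_psi_mulVec_eq {A : Matrix (Fin 4) (Fin 4) ℝ} (hA : A ∈ SO22) {X Y X' Y' : E22}
    (h : IsUnitFuture X Y) (h' : IsUnitFuture X' Y')
    (e : psi (A.mulVec X) (A.mulVec Y) = psi (A.mulVec X') (A.mulVec Y')) :
    psi X Y = psi X' Y' := by
  obtain ⟨e0, e1, e2⟩ := rotate_of_psi_eq (h.mulVec hA) (h'.mulVec hA) e
  rw [hA.1, hA.1, ← Matrix.mulVec_smul, ← Matrix.mulVec_smul, ← Matrix.mulVec_neg,
    ← Matrix.mulVec_add] at e2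
  rw [hA.1, hA.1, ← Matrix.mulVec_smul, ← Matrix.mulVec_smul, ← Matrix.mulVec_add] at e1
  rw [hA.1, hA.1] at e0
  exact (psi_rotate X Y (a := -form Y Y') (b := form X Y') (by rw [neg_sq]; exact e0)).symm.trans
    (congrArg₂ psi (mulVec_injective_of_mem_SO22 hA e1).symm
      (mulVec_injective_of_mem_SO22 hA e2).symm)

/-! ### Local developing maps -/

section

variable {M : Type*} [TopologicalSpace M] [ChartedSpace (EuclideanSpace ℝ (Fin 3)) M]

/-- `D` is a local developing map near `x`: it differs from the chart `dev x` by an element of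
`SO₀(2,2)`. -/
def IsLocalDev (S : AdSStructure M) (D : M → E22) (x : M) : Prop :=
  ∃ A ∈ SO22, ∀ᶠ y in 𝓝 x, D y = A.mulVec (S.dev x y)

/-- The tangent vector `w`, read through the differential of `D`. -/
def vecOf (D : M → E22) (w : TM M) : E22 := mfderiv (𝓡 3) 𝓘(ℝ, E22) D w.proj w.2

variable {S : AdSStructure M} {D : M → E22} {x : M}

theorem isLocalDev_dev {q : M} (h : x ∈ S.source q) : IsLocalDev S (S.dev q) x :=
  S.compatible x q x ⟨S.mem_source x, h⟩

theorem IsLocalDev.congr {D' : M → E22} (h : IsLocalDev S D x) (e : D' =ᶠ[𝓝 x] D) :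
    IsLocalDev S D' x := by
  obtain ⟨A, hA, hD⟩ := h
  refine ⟨A, hA, ?_⟩
  filter_upwards [hD, e] with y h1 h2
  rw [h2, h1]

theorem IsLocalDev.mulVec {A : Matrix (Fin 4) (Fin 4) ℝ} (h : IsLocalDev S D x) (hA : A ∈ SO22) :
    IsLocalDev S (fun y => A.mulVec (D y)) x := by
  obtain ⟨B, hB, hD⟩ := h
  refine ⟨A * B, mul_mem_SO22 hA hB, ?_⟩
  filter_upwards [hD] with y hy
  rw [hy, Matrix.mulVec_mulVec]

theorem IsLocalDev.eventually (h : IsLocalDev S D x) : ∀ᶠ y in 𝓝 x, IsLocalDev S D y := by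
  obtain ⟨A, hA, hD⟩ := h
  filter_upwards [hD.eventually_nhds, (S.isOpen_source x).mem_nhds (S.mem_source x)] with y h1 h2
  exact ((isLocalDev_dev h2).mulVec hA).congr h1

theorem contMDiffAt_dev {q : M} (h : x ∈ S.source q) :
    ContMDiffAt (𝓡 3) 𝓘(ℝ, E22) ∞ (S.dev q) x :=
  (S.smooth_dev q).contMDiffAt ((S.isOpen_source q).mem_nhds h)

/-- Multiplication by a matrix as a continuous linear map. -/
def mulVecCLM (A : Matrix (Fin 4) (Fin 4) ℝ) : E22 →L[ℝ] E22 :=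
  LinearMap.toContinuousLinearMap A.mulVecLin

theorem mulVecCLM_apply (A : Matrix (Fin 4) (Fin 4) ℝ) (x : E22) : mulVecCLM A x = A.mulVec x := rfl

theorem IsLocalDev.contMDiffAt (h : IsLocalDev S D x) : ContMDiffAt (𝓡 3) 𝓘(ℝ, E22) ∞ D x := by
  obtain ⟨A, hA, hD⟩ := h
  refine ContMDiffAt.congr_of_eventuallyEq ?_ hD
  exact (mulVecCLM A).contMDiff.contMDiffAt.comp x (contMDiffAt_dev (S.mem_source x))

theorem IsLocalDev.mdifferentiableAt (h : IsLocalDev S D x) :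
    MDifferentiableAt (𝓡 3) 𝓘(ℝ, E22) D x :=
  h.contMDiffAt.mdifferentiableAt (by simp)

theorem IsLocalDev.mem_quadric (h : IsLocalDev S D x) : D x ∈ quadric := by
  obtain ⟨A, hA, hD⟩ := h
  rw [hD.self_of_nhds, quadric, mem_ofPred_eq, hA.1]
  exact S.dev_mem x x (S.mem_source x)

theorem vecOf_mulVec (A : Matrix (Fin 4) (Fin 4) ℝ) {w : TM M}
    (h : MDifferentiableAt (𝓡 3) 𝓘(ℝ, E22) D w.proj) :
    vecOf (fun y => A.mulVec (D y)) w = A.mulVec (vecOf D w) := by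
  have h1 : HasMFDerivAt 𝓘(ℝ, E22) 𝓘(ℝ, E22) (mulVecCLM A) (D w.proj) (mulVecCLM A) :=
    (mulVecCLM A).hasMFDerivAt
  have := (h1.comp w.proj h.hasMFDerivAt).mfderiv
  exact congrArg (fun L => L w.2) this

theorem vecOf_congr {D' : M → E22} {w : TM M} (e : D' =ᶠ[𝓝 w.proj] D) : vecOf D' w = vecOf D w := by
  unfold vecOf
  rw [e.mfderiv_eq]
  rfl

/-- A local developing map around `x` is related to each chart around `x` by an isometry,
on base points and on tangent vectors. -/
theorem IsLocalDev.exists_mulVec (h : IsLocalDev S D x) {q : M} (hq : x ∈ S.source q) :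
    ∃ A ∈ SO22, ∀ᶠ y in 𝓝 x,
      D y = A.mulVec (S.dev q y) ∧ ∀ v, vecOf D ⟨y, v⟩ = A.mulVec (vecOf (S.dev q) ⟨y, v⟩) := by
  obtain ⟨A, hA, hD⟩ := h
  obtain ⟨B, hB, hE⟩ := S.compatible q x x ⟨hq, S.mem_source x⟩
  have hDE : ∀ᶠ y in 𝓝 x, D y = (A * B).mulVec (S.dev q y) := by
    filter_upwards [hD, hE] with y h1 h2
    rw [h1, h2, Matrix.mulVec_mulVec]
  refine ⟨A * B, mul_mem_SO22 hA hB, ?_⟩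
  filter_upwards [hDE.eventually_nhds, (S.isOpen_source q).mem_nhds hq] with y h1 h2
  refine ⟨h1.self_of_nhds, fun v => ?_⟩
  rw [vecOf_congr (w := ⟨y, v⟩) h1, vecOf_mulVec]
  exact (contMDiffAt_dev h2).mdifferentiableAt (by simp)

theorem IsLocalDev.isUnitFuture {U : Set M} {w : TM M} (h : IsLocalDev S D w.proj)
    (hw : w ∈ unitFuture S U) : IsUnitFuture (D w.proj) (vecOf D w) := by
  obtain ⟨A, hA, hD⟩ := h.exists_mulVec (S.mem_source _)
  obtain ⟨h1, h2⟩ := hD.self_of_nhds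
  rw [h1, show vecOf D w = _ from h2 w.2]
  refine IsUnitFuture.mulVec hA ?_
  rw [isUnitFuture_iff (S.dev_mem _ _ (S.mem_source _))]
  exact hw.2

/-- The conditions defining `T^{1,t}U` can be checked in any chart. -/
theorem mem_unitFuture {U : Set M} {w : TM M} {q : M} (hq : w.proj ∈ S.source q) (hU : w.proj ∈ U)
    (h : IsUnitFuture (S.dev q w.proj) (vecOf (S.dev q) w)) : w ∈ unitFuture S U := by
  refine ⟨hU, (isUnitFuture_iff (S.dev_mem _ _ (S.mem_source _))).1 ?_⟩
  obtain ⟨A, hA, hD⟩ := S.compatible q w.proj w.proj ⟨hq, S.mem_source _⟩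
  have h1 : pos S w.proj w = A.mulVec (S.dev q w.proj) := hD.self_of_nhds
  have h2 : vec S w.proj w = A.mulVec (vecOf (S.dev q) w) := by
    rw [← vecOf_mulVec A ((contMDiffAt_dev hq).mdifferentiableAt (by simp))]
    exact vecOf_congr hD
  rw [show S.dev w.proj w.proj = _ from h1, h2]
  exact h.mulVec hA

variable [IsManifold (𝓡 3) ∞ M]

theorem IsLocalDev.contMDiffAt_vecOf {w : TM M} (h : IsLocalDev S D w.proj) :
    ContMDiffAt (𝓡 3).tangent 𝓘(ℝ, E22) ∞ (vecOf D) w := by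
  have : IsManifold (𝓡 3) 1 M := IsManifold.of_le (n := ∞) (by simp)
  obtain ⟨O, hO, hOo, hxO⟩ := _root_.mem_nhds_iff.1 h.eventually
  have hD : ContMDiffOn (𝓡 3) 𝓘(ℝ, E22) ∞ D O :=
    fun y hy => (IsLocalDev.contMDiffAt (hO hy)).contMDiffWithinAt
  have hT := hD.contMDiffOn_tangentMapWithin (m := ∞) (by simp) hOo.uniqueMDiffOn
  have hop : IsOpen (Bundle.TotalSpace.proj ⁻¹' O : Set (TM M)) :=
    hOo.preimage (FiberBundle.continuous_proj _ _)
  have hTw := hT.contMDiffAt (hop.mem_nhds (show w ∈ _ from hxO))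
  have := (contMDiff_snd_tangentBundle_modelSpace (n := ∞) E22 𝓘(ℝ, E22)).contMDiffAt.comp w hTw
  refine this.congr_of_eventuallyEq ?_
  filter_upwards [hop.mem_nhds (show w ∈ _ from hxO)] with u hu
  change mfderiv (𝓡 3) 𝓘(ℝ, E22) D u.proj u.2 = mfderivWithin (𝓡 3) 𝓘(ℝ, E22) D O u.proj u.2
  rw [mfderivWithin_of_isOpen hOo hu]

theorem tendsto_proj (w : TM M) :
    Tendsto (fun u : TM M => u.proj) (𝓝 w) (𝓝 w.proj) :=
  (FiberBundle.continuous_proj (EuclideanSpace ℝ (Fin 3))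
    (TangentSpace (𝓡 3) : M → Type _)).tendsto w

theorem IsLocalDev.contMDiffAt_proj {w : TM M} (h : IsLocalDev S D w.proj) :
    ContMDiffAt (𝓡 3).tangent 𝓘(ℝ, E22) ∞ (fun u : TM M => D u.proj) w :=
  h.contMDiffAt.comp w (Bundle.contMDiff_proj (TangentSpace (𝓡 3)) w)

theorem contMDiffAt_psi {w : TM M} (h : IsLocalDev S D w.proj) :
    ContMDiffAt (𝓡 3).tangent 𝓘(ℝ, E21 × E21) ∞ (fun u : TM M => psi (D u.proj) (vecOf D u)) w :=
  (psiCLM.contMDiff.contMDiffAt.comp w h.contMDiffAt_proj).clm_apply h.contMDiffAt_vecOf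

/-! ### Velocities and the geodesic equation -/

omit [IsManifold (𝓡 3) ∞ M] in
theorem hasDerivAt_form {x y : ℝ → E22} {x' y' : E22} {t : ℝ} (hx : HasDerivAt x x' t)
    (hy : HasDerivAt y y' t) :
    HasDerivAt (fun s => form (x s) (y s)) (form x' (y t) + form (x t) y') t := by
  have hx := hasDerivAt_pi.1 hx
  have hy := hasDerivAt_pi.1 hy
  have := ((((hx 0).mul (hy 0)).neg.sub ((hx 1).mul (hy 1))).add ((hx 2).mul (hy 2))).add
    ((hx 3).mul (hy 3))
  refine this.congr_deriv ?_
  simp only [form]; ring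


omit [IsManifold (𝓡 3) ∞ M] in
theorem hasDerivAt_comp_dev {c : ℝ → M} {t : ℝ} (h : IsLocalDev S D (c t))
    (hc : MDifferentiableAt 𝓘(ℝ, ℝ) (𝓡 3) c t) :
    HasDerivAt (fun s => D (c s)) (vecOf D (velocity c t)) t := by
  have h1 := h.mdifferentiableAt.hasMFDerivAt.comp t hc.hasMFDerivAt
  have h2 : ∀ L : ℝ →L[ℝ] E22, HasFDerivAt (fun s => D (c s)) L t →
    HasDerivAt (fun s => D (c s)) (L 1) t := fun L hL => hL.hasDerivAt
  exact h2 _ (hasMFDerivAt_iff_hasFDerivAt.1 h1)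

/-- Continuity of the tangent map of `σ`, on the tangent bundle `E × E` of a vector space. -/
theorem continuousOn_tangentMap_prod {E : Type*} [NormedAddCommGroup E] [NormedSpace ℝ E]
    {σ : E → M} {O : Set E} (hO : IsOpen O) (h : ContMDiffOn 𝓘(ℝ, E) (𝓡 3) ∞ σ O) :
    ContinuousOn (fun p : E × E => (⟨σ p.1, mfderiv 𝓘(ℝ, E) (𝓡 3) σ p.1 p.2⟩ : TM M))
      (O ×ˢ univ) := by
  have : IsManifold (𝓡 3) 1 M := IsManifold.of_le (n := ∞) (by simp)
  have h1 := h.continuousOn_tangentMapWithin (by simp) hO.uniqueMDiffOn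
  have h2 : Continuous (fun p : E × E => (⟨p.1, p.2⟩ : TangentBundle 𝓘(ℝ, E) E)) :=
    (tangentBundleModelSpaceHomeomorph 𝓘(ℝ, E)).symm.continuous
  refine (h1.comp h2.continuousOn (fun p hp => hp.1)).congr fun p hp => ?_
  simp only [Function.comp_apply, tangentMapWithin]
  rw [mfderivWithin_of_isOpen hO hp.1]

theorem continuousOn_velocity {c : ℝ → M} {J : Set ℝ} (hJ : IsOpen J)
    (hc : ContMDiffOn 𝓘(ℝ, ℝ) (𝓡 3) ∞ c J) : ContinuousOn (velocity c) J :=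
  (continuousOn_tangentMap_prod hJ hc).comp (f := fun s : ℝ => (s, (1 : ℝ)))
    (by fun_prop) (fun s hs => ⟨hs, mem_univ _⟩)

omit [IsManifold (𝓡 3) ∞ M] in
/-- In a local developing map, a future unit time-like geodesic satisfies `x'' = -x`. -/
theorem hasDerivAt_vecOf_velocity {U : Set M} {c : ℝ → M} {J : Set ℝ} (hJ : IsOpen J)
    (hc : IsGeodesicOn S c J) (hu : ∀ t ∈ J, velocity c t ∈ unitFuture S U) {t : ℝ} (ht : t ∈ J)
    (h : IsLocalDev S D (c t)) :
    HasDerivAt (fun s => vecOf D (velocity c s)) (-D (c t)) t := by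
  have hcont : ContinuousAt c t := (hc.1.contMDiffAt (hJ.mem_nhds ht)).continuousAt
  have hmd : ∀ s ∈ J, MDifferentiableAt 𝓘(ℝ, ℝ) (𝓡 3) c s := fun s hs =>
    (hc.1.contMDiffAt (hJ.mem_nhds hs)).mdifferentiableAt (by simp)
  -- first for the chart used in the definition of the covariant derivative
  have key : HasDerivAt (fun s => vecOf (S.dev (c t)) (velocity c s)) (-S.dev (c t) (c t)) t := by
    set E := S.dev (c t) with hE
    have hloc : ∀ᶠ s in 𝓝 t, s ∈ J ∧ IsLocalDev S E (c s) :=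
      Filter.Eventually.and (hJ.mem_nhds ht)
        (hcont.eventually (isLocalDev_dev (S.mem_source (c t))).eventually)
    have hx : ∀ᶠ s in 𝓝 t, HasDerivAt (fun s => E (c s)) (vecOf E (velocity c s)) s := by
      filter_upwards [hloc] with s hs
      exact hasDerivAt_comp_dev hs.2 (hmd s hs.1)
    have hsm : ContDiffAt ℝ ∞ (fun s => E (c s)) t :=
      contMDiffAt_iff_contDiffAt.1 ((isLocalDev_dev (S.mem_source (c t))).contMDiffAt.comp t
        (hc.1.contMDiffAt (hJ.mem_nhds ht)))
    have hyd : DifferentiableAt ℝ (fun s => vecOf E (velocity c s)) t := by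
      have h1 : ContDiffAt ℝ ∞ (deriv (fun s => E (c s))) t := by
        exact (hsm.fderiv_right (m := ∞) (by simp)).clm_apply contDiffAt_const
      refine (h1.differentiableAt (by simp)).congr_of_eventuallyEq ?_
      filter_upwards [hx] with s hs
      exact hs.deriv.symm
    have hy := hyd.hasDerivAt
    have hu' : ∀ᶠ s in 𝓝 t, IsUnitFuture (E (c s)) (vecOf E (velocity c s)) := by
      filter_upwards [hloc] with s hs
      exact IsLocalDev.isUnitFuture (w := velocity c s) hs.2 (hu s hs.1)
    have hcov := hc.2 t ht
    change tangentProj (E (c t)) (deriv (fun s => vecOf E (velocity c s)) t) = 0 at hcov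
    set η' := deriv (fun s => vecOf E (velocity c s)) t
    have hform : form (vecOf E (velocity c t)) (vecOf E (velocity c t)) + form (E (c t)) η' = 0 := by
      have d := hasDerivAt_form hx.self_of_nhds hy
      have e : (fun s => form (E (c s)) (vecOf E (velocity c s))) =ᶠ[𝓝 t] fun _ => 0 := by
        filter_upwards [hu'] with s hs using hs.2.1
      have := d.unique ((hasDerivAt_const t (0 : ℝ)).congr_of_eventuallyEq e)
      linarith
    rw [hu'.self_of_nhds.2.2.1] at hform
    rw [tangentProj, form_comm, show form (E (c t)) η' = 1 by linarith, one_smul] at hcov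
    rwa [eq_neg_of_add_eq_zero_left hcov] at hy
  obtain ⟨A, hA, hD⟩ := h.exists_mulVec (S.mem_source _)
  rw [hD.self_of_nhds.1, ← Matrix.mulVec_neg]
  refine ((mulVecCLM A).hasFDerivAt.comp_hasDerivAt t key).congr_of_eventuallyEq ?_
  filter_upwards [hcont.eventually hD] with s hs
  exact hs.2 _

omit [IsManifold (𝓡 3) ∞ M] in
theorem hasDerivAt_psi {U : Set M} {c : ℝ → M} {J : Set ℝ} (hJ : IsOpen J)
    (hc : IsGeodesicOn S c J) (hu : ∀ t ∈ J, velocity c t ∈ unitFuture S U) {t : ℝ} (ht : t ∈ J)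
    (h : IsLocalDev S D (c t)) :
    HasDerivAt (fun s => psi (D (c s)) (vecOf D (velocity c s))) 0 t := by
  have hx := hasDerivAt_comp_dev h
    ((hc.1.contMDiffAt (hJ.mem_nhds ht)).mdifferentiableAt (by simp))
  have hy := hasDerivAt_vecOf_velocity hJ hc hu ht h
  have := psiCLM.hasDerivAt_of_bilinear (fun _ => hx) (fun _ => hy)
  rw [map_neg, psiCLM_apply, psiCLM_apply, psi_self, psi_self, neg_zero, add_zero] at this
  exact this

omit [IsManifold (𝓡 3) ∞ M] in
/-- `psi` is constant along geodesics. -/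
theorem psi_eq_of_joined {U : Set M} {N : Set (TM M)} (hN : N ⊆ unitFuture S U)
    (h : ∀ w ∈ N, IsLocalDev S D w.proj) {v w : TM M} (hj : Joined S N v w) :
    psi (D v.proj) (vecOf D v) = psi (D w.proj) (vecOf D w) := by
  obtain ⟨c, J, hJ, hJc, hc, hu, s, hs, t, ht, rfl, rfl⟩ := hj
  have hd : ∀ t ∈ J, HasDerivAt (fun s => psi (D (c s)) (vecOf D (velocity c s))) 0 t :=
    fun t ht => hasDerivAt_psi hJ hc (fun t ht => hN (hu t ht)) ht (h _ (hu t ht))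
  exact hJ.is_const_of_deriv_eq_zero hJc.isPreconnected
    (fun t ht => (hd t ht).differentiableAt.differentiableWithinAt)
    (fun t ht => (hd t ht).deriv) hs ht

end

/-! ### Local inverses of the charts -/

section

variable {M : Type*} [TopologicalSpace M] [ChartedSpace (EuclideanSpace ℝ (Fin 3)) M]
variable {S : AdSStructure M} {D : M → E22} {x : M} {q : M}

/-- A local inverse `σ` of the chart `dev q`. As the quadric is not a manifold in this encoding, `σ`
is a smooth map on an open subset `O` of `ℝ^{2,2}`; it maps `O ∩ quadric` bijectively to the open
subset `W` of `M`. -/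
structure LocalSection (S : AdSStructure M) (q : M) where
  σ : E22 → M
  O : Set E22
  W : Set M
  isOpen_O : IsOpen O
  isOpen_W : IsOpen W
  W_subset : W ⊆ S.source q
  smooth : ContMDiffOn 𝓘(ℝ, E22) (𝓡 3) ∞ σ O
  dev_mem : ∀ y ∈ W, S.dev q y ∈ O
  left_inv : ∀ y ∈ W, σ (S.dev q y) = y
  map_mem : ∀ Z ∈ O, Z ∈ quadric → σ Z ∈ W
  right_inv : ∀ Z ∈ O, Z ∈ quadric → S.dev q (σ Z) = Z

/-- The differential of a developing map takes values in the tangent space of the quadric. -/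
theorem form_vecOf (h : IsLocalDev S D x) (v : TangentSpace (𝓡 3) x) :
    form (D x) (vecOf D ⟨x, v⟩) = 0 := by
  have h1 := h.mdifferentiableAt.hasMFDerivAt
  have hc : HasFDerivAt (fun Z : E22 => form Z Z)
      (fderiv ℝ (fun Z : E22 => form Z Z) (D x)) (D x) := by
    refine DifferentiableAt.hasFDerivAt ?_
    unfold form; fun_prop
  have h2 := (hasMFDerivAt_iff_hasFDerivAt.2 hc).comp x h1
  have e : ((fun Z : E22 => form Z Z) ∘ D) =ᶠ[𝓝 x] fun _ => (-1 : ℝ) := by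
    filter_upwards [h.eventually] with y hy using hy.mem_quadric
  have h3 := hasMFDerivAt_unique (h2.congr_of_eventuallyEq e.symm) (hasMFDerivAt_const (-1 : ℝ) x)
  have h4 : fderiv ℝ (fun Z : E22 => form Z Z) (D x) (vecOf D ⟨x, v⟩) = 0 :=
    congrArg (fun L => L v) h3
  have h5 : HasDerivAt (fun s : ℝ => D x + s • vecOf D ⟨x, v⟩) (vecOf D ⟨x, v⟩) 0 := by
    simpa using ((hasDerivAt_id (0 : ℝ)).smul_const (vecOf D ⟨x, v⟩)).const_add (D x)
  have h6 := HasFDerivAt.comp_hasDerivAt_of_eq (0 : ℝ) hc h5 (by simp)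
  have h7 := h6.unique (hasDerivAt_form h5 h5)
  rw [h4] at h7
  simp only [zero_smul, add_zero] at h7
  rw [form_comm (vecOf D ⟨x, v⟩)] at h7
  linarith

/-- The extension `(y, r) ↦ (1 + r) f(y)` of a local parametrization `f` of `AdS₃` to a local
diffeomorphism into `ℝ^{2,2}`. -/
def coneMap (S : AdSStructure M) (q x : M) (p : EuclideanSpace ℝ (Fin 3) × ℝ) : E22 :=
  (1 + p.2) • S.dev q ((extChartAt (𝓡 3) x).symm p.1)

variable [IsManifold (𝓡 3) ∞ M]

theorem contDiffAt_coneMap {p : EuclideanSpace ℝ (Fin 3) × ℝ}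
    (hp : p.1 ∈ (extChartAt (𝓡 3) x).target)
    (hq : (extChartAt (𝓡 3) x).symm p.1 ∈ S.source q) :
    ContDiffAt ℝ ∞ (coneMap S q x) p := by
  have h1 : ContMDiffAt 𝓘(ℝ, EuclideanSpace ℝ (Fin 3)) (𝓡 3) ∞ (extChartAt (𝓡 3) x).symm p.1 :=
    (contMDiffOn_extChartAt_symm x).contMDiffAt ((isOpen_extChartAt_target x).mem_nhds hp)
  have h2 : ContDiffAt ℝ ∞ (fun y => S.dev q ((extChartAt (𝓡 3) x).symm y)) p.1 :=
    contMDiffAt_iff_contDiffAt.1 ((contMDiffAt_dev hq).comp p.1 h1)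
  exact (contDiffAt_const.add contDiffAt_snd).smul (h2.comp p contDiffAt_fst)

theorem exists_equiv_coneMap {p : EuclideanSpace ℝ (Fin 3) × ℝ}
    (hp : p.1 ∈ (extChartAt (𝓡 3) x).target)
    (hq : (extChartAt (𝓡 3) x).symm p.1 ∈ S.source q) (hr : 1 + p.2 ≠ 0) :
    ∃ e : (EuclideanSpace ℝ (Fin 3) × ℝ) ≃L[ℝ] E22,
      HasFDerivAt (coneMap S q x) (e : (EuclideanSpace ℝ (Fin 3) × ℝ) →L[ℝ] E22) p := by
  set φ := (extChartAt (𝓡 3) x).symm with hφ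
  have h1 : MDifferentiableAt 𝓘(ℝ, EuclideanSpace ℝ (Fin 3)) (𝓡 3) φ p.1 :=
    ((contMDiffOn_extChartAt_symm (n := ∞) x).contMDiffAt
      ((isOpen_extChartAt_target x).mem_nhds hp)).mdifferentiableAt (by simp)
  have hdev := isLocalDev_dev (S := S) hq
  have h2 := hdev.mdifferentiableAt.hasMFDerivAt.comp p.1 h1.hasMFDerivAt
  obtain ⟨L, hL, hLv⟩ : ∃ L : EuclideanSpace ℝ (Fin 3) →L[ℝ] E22,
      HasFDerivAt (fun y => S.dev q (φ y)) L p.1 ∧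
      ∀ v, L v = vecOf (S.dev q) ⟨φ p.1, mfderiv 𝓘(ℝ, EuclideanSpace ℝ (Fin 3)) (𝓡 3) φ p.1 v⟩ :=
    ⟨_, hasMFDerivAt_iff_hasFDerivAt.1 h2, fun v => rfl⟩
  have hinj : ∀ v, L v = 0 → v = 0 := by
    intro v hv
    rw [hLv] at hv
    have h3 : mfderiv 𝓘(ℝ, EuclideanSpace ℝ (Fin 3)) (𝓡 3) φ p.1 v = 0 :=
      S.immersion q _ hq (by rw [map_zero]; exact hv)
    have h4 := (isInvertible_mfderivWithin_extChartAt_symm (I := 𝓡 3) (x := x) hp).injective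
    rw [← mfderivWithin_univ, ← ModelWithCorners.range_eq_univ (𝓡 3)] at h3
    exact h4 (h3.trans (ContinuousLinearMap.map_zero _).symm)
  have hF : HasFDerivAt (coneMap S q x)
      ((1 + p.2) • (L.comp (ContinuousLinearMap.fst ℝ (EuclideanSpace ℝ (Fin 3)) ℝ)) +
        (ContinuousLinearMap.snd ℝ (EuclideanSpace ℝ (Fin 3)) ℝ).smulRight (S.dev q (φ p.1))) p :=
    ((hasFDerivAt_snd (𝕜 := ℝ)).const_add (1 : ℝ)).smul (hL.comp p hasFDerivAt_fst)
  set F' := ((1 + p.2) • (L.comp (ContinuousLinearMap.fst ℝ (EuclideanSpace ℝ (Fin 3)) ℝ)) +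
        (ContinuousLinearMap.snd ℝ (EuclideanSpace ℝ (Fin 3)) ℝ).smulRight (S.dev q (φ p.1)))
    with hF'
  have hFinj : Function.Injective F'.toLinearMap := by
    rw [← LinearMap.ker_eq_bot, LinearMap.ker_eq_bot']
    rintro ⟨v, r⟩ h
    have h' : (1 + p.2) • L v + r • S.dev q (φ p.1) = 0 := h
    have h3 := congrArg (form (S.dev q (φ p.1))) h'
    rw [form_add_right, form_smul_right, form_smul_right, hLv, form_vecOf hdev,
      show form (S.dev q (φ p.1)) (S.dev q (φ p.1)) = -1 from hdev.mem_quadric] at h3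
    have hr0 : r = 0 := by
      have : form (S.dev q (φ p.1)) 0 = 0 := by simp [form]
      rw [this] at h3; linarith
    rw [hr0, zero_smul, add_zero, smul_eq_zero] at h'
    rw [hinj v (h'.resolve_left hr), hr0]; rfl
  have hdim : Module.finrank ℝ (EuclideanSpace ℝ (Fin 3) × ℝ) = Module.finrank ℝ E22 := by simp
  exact ⟨(LinearMap.linearEquivOfInjective F'.toLinearMap hFinj hdim).toContinuousLinearEquiv, hF⟩

/-- The inverse function theorem, applied to `coneMap`, gives local inverses of the charts. -/
theorem exists_localSection (hx : x ∈ S.source q) : ∃ L : LocalSection S q, x ∈ L.W := by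
  set φ := extChartAt (𝓡 3) x with hφ
  have hxt : φ x ∈ φ.target := mem_extChartAt_target x
  have hxx : φ.symm (φ x) = x := extChartAt_to_inv x
  have hcs : ContinuousOn φ.symm φ.target := continuousOn_extChartAt_symm x
  have hto : IsOpen φ.target := isOpen_extChartAt_target x
  set T : Set (EuclideanSpace ℝ (Fin 3) × ℝ) :=
    (φ.target ∩ φ.symm ⁻¹' S.source q) ×ˢ Ioo (-1) 1 with hT
  have hTo : IsOpen T := (hcs.isOpen_inter_preimage hto (S.isOpen_source q)).prod isOpen_Ioo
  have hT1 : ∀ p ∈ T, ContDiffAt ℝ ∞ (coneMap S q x) p := fun p hp =>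
    contDiffAt_coneMap hp.1.1 hp.1.2
  have hT2 : ∀ p ∈ T, ∃ e : (EuclideanSpace ℝ (Fin 3) × ℝ) ≃L[ℝ] E22,
      HasFDerivAt (coneMap S q x) (e : (EuclideanSpace ℝ (Fin 3) × ℝ) →L[ℝ] E22) p := fun p hp =>
    exists_equiv_coneMap hp.1.1 hp.1.2 (by linarith [hp.2.1])
  have hp0 : (φ x, (0 : ℝ)) ∈ T := ⟨⟨hxt, by rw [mem_preimage, hxx]; exact hx⟩, by simp⟩
  obtain ⟨e0, he0⟩ := hT2 _ hp0
  set Ψ := ((hT1 _ hp0).toOpenPartialHomeomorph _ he0 (by simp)).restrOpen T hTo with hΨ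
  have hΨs : ∀ p ∈ Ψ.source, p ∈ T := fun p hp => hp.2
  have hΨ0 : (φ x, (0 : ℝ)) ∈ Ψ.source :=
    ⟨(hT1 _ hp0).mem_toOpenPartialHomeomorph_source he0 (by simp), hp0⟩
  have hΨc : ∀ p, Ψ p = coneMap S q x p := fun p => rfl
  -- a point of the quadric has vanishing cone coordinate
  have hzero : ∀ Z ∈ Ψ.target, Z ∈ quadric →
      (Ψ.symm Z).2 = 0 ∧ S.dev q (φ.symm (Ψ.symm Z).1) = Z := by
    intro Z hZ hZq
    have h1 := Ψ.right_inv hZ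
    have h2 := hΨs _ (Ψ.map_target hZ)
    have h3 : form (S.dev q (φ.symm (Ψ.symm Z).1)) (S.dev q (φ.symm (Ψ.symm Z).1)) = -1 :=
      S.dev_mem q _ h2.1.2
    rw [hΨc, coneMap] at h1
    have h4 : form Z Z = -1 := hZq
    rw [← h1, form_smul_left, form_smul_right, h3] at h4
    have h5 : (Ψ.symm Z).2 = 0 := by
      have h6 := h2.2.1
      have : ((Ψ.symm Z).2) * ((Ψ.symm Z).2 + 2) = 0 := by linarith
      rcases mul_eq_zero.1 this with h | h
      · exact h
      · linarith
    refine ⟨h5, ?_⟩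
    rwa [h5, add_zero, one_smul] at h1
  refine ⟨{
    σ := fun Z => φ.symm (Ψ.symm Z).1
    O := Ψ.target
    W := φ.source ∩ φ ⁻¹' ((fun y => (y, (0 : ℝ))) ⁻¹' Ψ.source)
    isOpen_O := Ψ.open_target
    isOpen_W := (continuousOn_extChartAt x).isOpen_inter_preimage (isOpen_extChartAt_source x)
      (Ψ.open_source.preimage (by fun_prop))
    W_subset := fun y hy => by
      have := (hΨs _ hy.2).1.2
      rwa [mem_preimage, φ.left_inv hy.1] at this
    smooth := ?_
    dev_mem := fun y hy => ?_
    left_inv := fun y hy => ?_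
    map_mem := fun Z hZ hZq => ?_
    right_inv := fun Z hZ hZq => (hzero Z hZ hZq).2 }, ?_⟩
  · have h1 : ContDiffOn ℝ ∞ Ψ.symm Ψ.target := by
      intro Z hZ
      obtain ⟨e, he⟩ := hT2 _ (hΨs _ (Ψ.map_target hZ))
      exact (Ψ.contDiffAt_symm hZ he (hT1 _ (hΨs _ (Ψ.map_target hZ)))).contDiffWithinAt
    exact (contMDiffOn_extChartAt_symm x).comp (contDiff_fst.comp_contDiffOn h1).contMDiffOn
      (fun Z hZ => (hΨs _ (Ψ.map_target hZ)).1.1)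
  · have : S.dev q y = Ψ (φ y, 0) := by
      rw [hΨc, coneMap, add_zero, one_smul, ← hφ, φ.left_inv hy.1]
    rw [this]; exact Ψ.map_source hy.2
  · have : S.dev q y = Ψ (φ y, 0) := by
      rw [hΨc, coneMap, add_zero, one_smul, ← hφ, φ.left_inv hy.1]
    rw [this, Ψ.left_inv hy.2, φ.left_inv hy.1]
  · have h2 := Ψ.map_target hZ
    have h3 := (hΨs _ h2).1.1
    refine ⟨φ.map_target h3, ?_⟩
    rw [mem_preimage, mem_preimage, φ.right_inv h3, ← (hzero Z hZ hZq).1]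
    exact h2
  · exact ⟨mem_extChartAt_source x, hΨ0⟩

end

/-! ### The geodesic flow -/

/-- The position at time `s` of the geodesic of `AdS₃` with initial velocity `p = (X, Y)`. -/
def geo (p : E22 × E22) (s : ℝ) : E22 := Real.cos s • p.1 + Real.sin s • p.2

/-- The velocity at time `s` of the geodesic of `AdS₃` with initial velocity `p = (X, Y)`. -/
def geo' (p : E22 × E22) (s : ℝ) : E22 := -(Real.sin s • p.1) + Real.cos s • p.2

theorem hasDerivAt_geo (p : E22 × E22) (s : ℝ) : HasDerivAt (geo p) (geo' p s) s := by
  have := ((Real.hasDerivAt_cos s).smul_const p.1).add ((Real.hasDerivAt_sin s).smul_const p.2)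
  exact this.congr_deriv (by rw [geo', neg_smul])

theorem hasDerivAt_geo' (p : E22 × E22) (s : ℝ) : HasDerivAt (geo' p) (-geo p s) s := by
  have := ((Real.hasDerivAt_sin s).smul_const p.1).neg.add
    ((Real.hasDerivAt_cos s).smul_const p.2)
  exact this.congr_deriv (by rw [geo]; module)

@[simp] theorem geo_zero (p : E22 × E22) : geo p 0 = p.1 := by simp [geo]

@[simp] theorem geo'_zero (p : E22 × E22) : geo' p 0 = p.2 := by simp [geo']

theorem continuous_geo : Continuous fun x : (E22 × E22) × ℝ => geo x.1 x.2 := by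
  unfold geo; fun_prop

theorem contDiff_geo (p : E22 × E22) : ContDiff ℝ ∞ (geo p) := by
  unfold geo; fun_prop

theorem psi_geo (p : E22 × E22) (s : ℝ) : psi (geo p s) (geo' p s) = psi p.1 p.2 :=
  psi_rotate p.1 p.2 (Real.cos_sq_add_sin_sq s)

theorem geo_mulVec (A : Matrix (Fin 4) (Fin 4) ℝ) (p : E22 × E22) (s : ℝ) :
    A.mulVec (geo p s) = geo (A.mulVec p.1, A.mulVec p.2) s := by
  simp [geo, Matrix.mulVec_add, Matrix.mulVec_smul]

theorem geo'_mulVec (A : Matrix (Fin 4) (Fin 4) ℝ) (p : E22 × E22) (s : ℝ) :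
    A.mulVec (geo' p s) = geo' (A.mulVec p.1, A.mulVec p.2) s := by
  simp [geo', Matrix.mulVec_add, Matrix.mulVec_smul, Matrix.mulVec_neg]

theorem form_timeField (X Y : E22) : form Y (timeField X) = -(psiL X Y 0 + psiR X Y 0) / 2 := by
  simp [form, timeField, psiL, psiR]; ring

theorem isUnitFuture_geo {p : E22 × E22} (h : IsUnitFuture p.1 p.2) (s : ℝ) :
    IsUnitFuture (geo p s) (geo' p s) := by
  obtain ⟨h1, h2, h3, h4⟩ := h
  have hcs := Real.cos_sq_add_sin_sq s
  have h2' := h2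
  rw [form_comm] at h2'
  have hn : ∀ x y : E22, form (-x) y = -form x y := fun x y => by simp [form]; ring
  have hn' : ∀ x y : E22, form x (-y) = -form x y := fun x y => by simp [form]; ring
  refine ⟨?_, ?_, ?_, ?_⟩
  · simp only [geo, form_add_left, form_add_right, form_smul_left, form_smul_right, h1, h2, h2', h3]
    linear_combination -hcs
  · simp only [geo, geo', form_add_left, form_add_right, form_smul_left, form_smul_right, hn',
      h1, h2, h2', h3]
    ring
  · simp only [geo', form_add_left, form_add_right, form_smul_left, form_smul_right, hn, hn',
      h1, h2, h2', h3]
    linear_combination -hcs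
  · have e := psi_geo p s
    simp only [psi, Prod.mk.injEq] at e
    rwa [form_timeField, e.1, e.2, ← form_timeField]

section

variable {M : Type*} [TopologicalSpace M] [ChartedSpace (EuclideanSpace ℝ (Fin 3)) M]
variable {S : AdSStructure M} {D : M → E22} {x : M} {q : M} {U : Set M}

/-- A tangent vector of `M`, read through `D` as a pair (point, vector). -/
def pairOf (D : M → E22) (w : TM M) : E22 × E22 := (D w.proj, vecOf D w)

/-- The tangent vector of `M` which the chart `dev q` maps to the pair (point, vector) `p`. -/
def LocalSection.lift (L : LocalSection S q) (p : E22 × E22) : TM M :=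
  ⟨L.σ p.1, mfderiv 𝓘(ℝ, E22) (𝓡 3) L.σ p.1 p.2⟩

theorem TM_ext {a b : M} {v v' : EuclideanSpace ℝ (Fin 3)} (h : a = b) (h' : v = v') :
    (⟨a, v⟩ : TM M) = ⟨b, v'⟩ := by subst h; subst h'; rfl

theorem LocalSection.lift_pairOf (L : LocalSection S q) {w : TM M} (hw : w.proj ∈ L.W) :
    L.lift (pairOf (S.dev q) w) = w := by
  have h1 := (contMDiffAt_dev (L.W_subset hw)).mdifferentiableAt (by simp)
  have h2 : MDifferentiableAt 𝓘(ℝ, E22) (𝓡 3) L.σ (S.dev q w.proj) :=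
    (L.smooth.contMDiffAt (L.isOpen_O.mem_nhds (L.dev_mem _ hw))).mdifferentiableAt (by simp)
  have e : (L.σ ∘ S.dev q) =ᶠ[𝓝 w.proj] id := by
    filter_upwards [L.isOpen_W.mem_nhds hw] with y hy using L.left_inv y hy
  have h3 := (h2.hasMFDerivAt.comp w.proj h1.hasMFDerivAt).mfderiv
  have h4 := e.mfderiv_eq.symm.trans h3
  rw [mfderiv_id] at h4
  exact TM_ext (L.left_inv _ hw) (congrArg (fun T => T w.2) h4).symm

theorem LocalSection.velocity_eq (L : LocalSection S q) {γ : ℝ → E22} {γ' : E22} {t : ℝ}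
    (h : HasDerivAt γ γ' t) (ht : γ t ∈ L.O) :
    velocity (fun s => L.σ (γ s)) t = L.lift (γ t, γ') := by
  have h2 : MDifferentiableAt 𝓘(ℝ, E22) (𝓡 3) L.σ (γ t) :=
    (L.smooth.contMDiffAt (L.isOpen_O.mem_nhds ht)).mdifferentiableAt (by simp)
  have h3 := (h2.hasMFDerivAt.comp t (hasMFDerivAt_iff_hasFDerivAt.2 h.hasFDerivAt)).mfderiv
  refine TM_ext rfl ?_
  refine (congrArg (fun T => T (1 : ℝ)) h3).trans ?_
  change mfderiv 𝓘(ℝ, E22) (𝓡 3) L.σ (γ t) ((1 : ℝ) • γ') = _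
  rw [one_smul]

theorem LocalSection.velocity_geo (L : LocalSection S q) {p : E22 × E22} {t : ℝ}
    (ht : geo p t ∈ L.O) :
    velocity (fun s => L.σ (geo p s)) t = L.lift (geo p t, geo' p t) :=
  L.velocity_eq (hasDerivAt_geo p t) ht

theorem LocalSection.pairOf_lift (L : LocalSection S q) {p : E22 × E22}
    (h : IsUnitFuture p.1 p.2) (hO : p.1 ∈ L.O) : pairOf (S.dev q) (L.lift p) = p := by
  refine Prod.ext (L.right_inv _ hO h.1) ?_
  set c : ℝ → M := fun s => L.σ (geo p s) with hc
  have h0 : geo p 0 ∈ L.O := by rwa [geo_zero]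
  have hmd : MDifferentiableAt 𝓘(ℝ, ℝ) (𝓡 3) c 0 :=
    (((L.smooth.contMDiffAt (L.isOpen_O.mem_nhds h0))).comp 0
      (contDiff_geo p).contMDiff.contMDiffAt).mdifferentiableAt (by simp)
  have hmem : c 0 ∈ S.source q := L.W_subset (L.map_mem _ h0 (isUnitFuture_geo h 0).1)
  have h1 := hasDerivAt_comp_dev (isLocalDev_dev hmem) hmd
  have e : (fun s => S.dev q (c s)) =ᶠ[𝓝 0] geo p := by
    filter_upwards [(hasDerivAt_geo p 0).continuousAt.eventually (L.isOpen_O.mem_nhds h0)] with s hs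
    exact L.right_inv _ hs (isUnitFuture_geo h s).1
  have h2 := h1.unique ((hasDerivAt_geo p 0).congr_of_eventuallyEq e)
  rw [hc, L.velocity_geo h0, geo_zero, geo'_zero] at h2
  exact h2

theorem LocalSection.lift_mem (L : LocalSection S q) {p : E22 × E22}
    (h : IsUnitFuture p.1 p.2) (hO : p.1 ∈ L.O) (hU : L.σ p.1 ∈ U) :
    L.lift p ∈ unitFuture S U := by
  have h1 := L.pairOf_lift h hO
  refine mem_unitFuture (q := q) (L.W_subset (L.map_mem _ hO h.1)) hU ?_
  rw [← h1] at h
  exact h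

/-- The local section turns the geodesics of the model into geodesics of `M`. -/
theorem LocalSection.isGeodesicOn (L : LocalSection S q) {p : E22 × E22}
    (h : IsUnitFuture p.1 p.2) {J : Set ℝ} (hJ : IsOpen J) (hO : ∀ s ∈ J, geo p s ∈ L.O) :
    IsGeodesicOn S (fun s => L.σ (geo p s)) J := by
  refine ⟨L.smooth.comp (contDiff_geo p).contMDiff.contMDiffOn hO, fun t ht => ?_⟩
  set c : ℝ → M := fun s => L.σ (geo p s) with hc
  have hcq : c t ∈ S.source q := L.W_subset (L.map_mem _ (hO t ht) (isUnitFuture_geo h t).1)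
  have hcont : ContinuousAt c t :=
    ((L.smooth.contMDiffAt (L.isOpen_O.mem_nhds (hO t ht)))).continuousAt.comp
      (hasDerivAt_geo p t).continuousAt
  obtain ⟨A, hA, hE⟩ := (isLocalDev_dev (S.mem_source (c t))).exists_mulVec hcq
  have h1 : S.dev (c t) (c t) = A.mulVec (geo p t) := by
    rw [hE.self_of_nhds.1, L.right_inv _ (hO t ht) (isUnitFuture_geo h t).1]
  have h2 : (fun s => vecOf (S.dev (c t)) (velocity c s)) =ᶠ[𝓝 t]
      fun s => A.mulVec (geo' p s) := by
    filter_upwards [hcont.eventually hE, hJ.mem_nhds ht] with s hs hsJ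
    have h3 := hs.2 (velocity c s).2
    have h4 := L.pairOf_lift (p := (geo p s, geo' p s)) (isUnitFuture_geo h s) (hO s hsJ)
    refine h3.trans (congrArg A.mulVec ?_)
    rw [← L.velocity_geo (hO s hsJ)] at h4
    exact congrArg Prod.snd h4
  have h5 := ((mulVecCLM A).hasFDerivAt.comp_hasDerivAt t
    (hasDerivAt_geo' p t)).congr_of_eventuallyEq h2
  change tangentProj (S.dev (c t) (c t)) (deriv (fun s => vecOf (S.dev (c t)) (velocity c s)) t) = 0
  rw [h5.deriv, h1, map_neg, mulVecCLM_apply, tangentProj]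
  have h6 : form (-A.mulVec (geo p t)) (A.mulVec (geo p t)) = 1 := by
    rw [← neg_one_smul ℝ, form_smul_left, hA.1, (isUnitFuture_geo h t).1]; norm_num
  rw [h6]; module

/-- The vector `w` and its image by the geodesic flow at time `θ` are joined in `T^{1,t}U`, if the
geodesic of the model stays in the domain of the local inverse and over `U`. -/
theorem LocalSection.joined (L : LocalSection S q) {w : TM M} (hW : w.proj ∈ L.W)
    (h : w ∈ unitFuture S U) {ε : ℝ}
    (hO : ∀ s, |s| < ε → geo (pairOf (S.dev q) w) s ∈ L.O ∧
      L.σ (geo (pairOf (S.dev q) w) s) ∈ U) {θ : ℝ} (hθ : |θ| < ε) :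
    Joined S (unitFuture S U) w
      (L.lift (geo (pairOf (S.dev q) w) θ, geo' (pairOf (S.dev q) w) θ)) := by
  have hp : IsUnitFuture (pairOf (S.dev q) w).1 (pairOf (S.dev q) w).2 :=
    (isLocalDev_dev (L.W_subset hW)).isUnitFuture h
  have hε : 0 < ε := (abs_nonneg θ).trans_lt hθ
  refine ⟨fun s => L.σ (geo (pairOf (S.dev q) w) s), Ioo (-ε) ε, isOpen_Ioo, ordConnected_Ioo,
    L.isGeodesicOn hp isOpen_Ioo fun s hs => (hO s (abs_lt.2 hs)).1, fun s hs => ?_,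
    0, ⟨by linarith, hε⟩, θ, abs_lt.1 hθ, ?_, ?_⟩
  · rw [L.velocity_geo (hO s (abs_lt.2 hs)).1]
    exact L.lift_mem (isUnitFuture_geo hp s) (hO s (abs_lt.2 hs)).1 (hO s (abs_lt.2 hs)).2
  · rw [L.velocity_geo (hO 0 (by simpa using hε)).1, geo_zero, geo'_zero]
    exact L.lift_pairOf hW
  · exact L.velocity_geo (hO θ hθ).1

variable [IsManifold (𝓡 3) ∞ M]

theorem IsLocalDev.continuousAt_pairOf {w : TM M} (h : IsLocalDev S D w.proj) :
    ContinuousAt (pairOf D) w :=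
  h.contMDiffAt_proj.continuousAt.prodMk h.contMDiffAt_vecOf.continuousAt

theorem LocalSection.continuousAt_lift (L : LocalSection S q) {p : E22 × E22} (hp : p.1 ∈ L.O) :
    ContinuousAt L.lift p :=
  (continuousOn_tangentMap_prod L.isOpen_O L.smooth).continuousAt
    ((L.isOpen_O.prod isOpen_univ).mem_nhds ⟨hp, mem_univ _⟩)

/-- A flow box: near `w`, the geodesics stay for a uniform time in the chart and in `U`. -/
theorem LocalSection.exists_box (L : LocalSection S q) (hU : IsOpen U) {w : TM M}
    (hW : w.proj ∈ L.W) (hwU : w.proj ∈ U) :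
    ∃ ε > 0, ∀ᶠ u in 𝓝 w, u.proj ∈ L.W ∧ ∀ s, |s| < ε →
      geo (pairOf (S.dev q) u) s ∈ L.O ∧ L.σ (geo (pairOf (S.dev q) u) s) ∈ U := by
  have hO' : IsOpen (L.O ∩ L.σ ⁻¹' U) := L.smooth.continuousOn.isOpen_inter_preimage L.isOpen_O hU
  have hp := (isLocalDev_dev (L.W_subset hW)).continuousAt_pairOf
  have hm : geo (pairOf (S.dev q) w) 0 ∈ L.O ∩ L.σ ⁻¹' U := by
    rw [geo_zero]
    exact ⟨L.dev_mem _ hW, by rw [mem_preimage]; simpa [pairOf, L.left_inv _ hW] using hwU⟩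
  have h1 : ∀ᶠ y in 𝓝 (pairOf (S.dev q) w, (0 : ℝ)), geo y.1 y.2 ∈ L.O ∩ L.σ ⁻¹' U :=
    continuous_geo.continuousAt.eventually (hO'.mem_nhds hm)
  rw [nhds_prod_eq] at h1
  obtain ⟨pa, ha, pb, hb, hab⟩ := eventually_prod_iff.1 h1
  obtain ⟨ε, hε, hball⟩ := Metric.eventually_nhds_iff.1 hb
  have hop : IsOpen (Bundle.TotalSpace.proj ⁻¹' L.W : Set (TM M)) :=
    L.isOpen_W.preimage (FiberBundle.continuous_proj _ _)
  refine ⟨ε, hε, ?_⟩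
  filter_upwards [hp.eventually ha, hop.mem_nhds (show w ∈ _ from hW)] with u hu hu'
  exact ⟨hu', fun s hs => hab hu (hball (by simpa using hs))⟩

omit [IsManifold (𝓡 3) ∞ M] in
/-- In a developing map, every geodesic of `M` is a geodesic of the model. -/
theorem pairOf_velocity {c : ℝ → M} {J : Set ℝ} (hJ : IsOpen J) (hJc : J.OrdConnected)
    (hc : IsGeodesicOn S c J) (hu : ∀ t ∈ J, velocity c t ∈ unitFuture S U)
    (hD : ∀ t ∈ J, IsLocalDev S D (c t)) {s t : ℝ} (hs : s ∈ J) (ht : t ∈ J) :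
    pairOf D (velocity c t) =
      (geo (pairOf D (velocity c s)) (t - s), geo' (pairOf D (velocity c s)) (t - s)) := by
  have hx : ∀ t ∈ J, HasDerivAt (fun s => D (c s)) (vecOf D (velocity c t)) t := fun t ht =>
    hasDerivAt_comp_dev (hD t ht)
      ((hc.1.contMDiffAt (hJ.mem_nhds ht)).mdifferentiableAt (by simp))
  have hy : ∀ t ∈ J, HasDerivAt (fun s => vecOf D (velocity c s)) (-D (c t)) t := fun t ht =>
    hasDerivAt_vecOf_velocity hJ hc hu ht (hD t ht)
  -- the pair, transported back to time `s` by the geodesic flow of the model, is constant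
  have hcos : ∀ r, HasDerivAt (fun r => Real.cos (r - s)) (-Real.sin (r - s)) r := fun r => by
    simpa using ((hasDerivAt_id r).sub_const s).cos
  have hsin : ∀ r, HasDerivAt (fun r => Real.sin (r - s)) (Real.cos (r - s)) r := fun r => by
    simpa using ((hasDerivAt_id r).sub_const s).sin
  have e1 : ∀ r ∈ J, HasDerivAt (fun r => Real.cos (r - s) • D (c r) -
      Real.sin (r - s) • vecOf D (velocity c r)) 0 r := fun r hr =>
    (((hcos r).smul (hx r hr)).sub ((hsin r).smul (hy r hr))).congr_deriv (by module)
  have e2 : ∀ r ∈ J, HasDerivAt (fun r => Real.sin (r - s) • D (c r) +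
      Real.cos (r - s) • vecOf D (velocity c r)) 0 r := fun r hr =>
    (((hsin r).smul (hx r hr)).add ((hcos r).smul (hy r hr))).congr_deriv (by module)
  have f1 := hJ.is_const_of_deriv_eq_zero hJc.isPreconnected
    (fun t ht => (e1 t ht).differentiableAt.differentiableWithinAt)
    (fun t ht => (e1 t ht).deriv) hs ht
  have f2 := hJ.is_const_of_deriv_eq_zero hJc.isPreconnected
    (fun t ht => (e2 t ht).differentiableAt.differentiableWithinAt)
    (fun t ht => (e2 t ht).deriv) hs ht
  simp only [sub_self, Real.cos_zero, Real.sin_zero, one_smul, zero_smul, sub_zero, zero_add] at f1 f2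
  have hcs := Real.cos_sq_add_sin_sq (t - s)
  refine Prod.ext ?_ ?_
  · change D (c t) = Real.cos (t - s) • D (c s) + Real.sin (t - s) • vecOf D (velocity c s)
    rw [f1, f2]
    ext i
    simp only [Pi.add_apply, Pi.sub_apply, Pi.smul_apply, smul_eq_mul]
    linear_combination -(D (c t) i) * hcs
  · change vecOf D (velocity c t) =
      -(Real.sin (t - s) • D (c s)) + Real.cos (t - s) • vecOf D (velocity c s)
    rw [f1, f2]
    ext i
    simp only [Pi.add_apply, Pi.sub_apply, Pi.smul_apply, Pi.neg_apply, smul_eq_mul]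
    linear_combination -(vecOf D (velocity c t) i) * hcs

end

/-! ### Propagation along geodesics -/

section

variable {M : Type*} [TopologicalSpace M] [ChartedSpace (EuclideanSpace ℝ (Fin 3)) M]
variable {S : AdSStructure M} {D : M → E22} {x : M} {q : M} {U : Set M}

theorem Joined.symm {N : Set (TM M)} {v w : TM M} (h : Joined S N v w) : Joined S N w v := by
  obtain ⟨c, J, hJ, hJc, hc, hu, s, hs, t, ht, h1, h2⟩ := h
  exact ⟨c, J, hJ, hJc, hc, hu, t, ht, s, hs, h2, h1⟩

variable [IsManifold (𝓡 3) ∞ M]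

/-- Near `v`, the relation `P` holds between geodesics and their invariants computed in some local
developing map. -/
def HoldsNear (S : AdSStructure M) (U : Set M) (P : GeodesicSpace S U → E21 × E21 → Prop)
    (v : unitFuture S U) : Prop :=
  ∃ D : M → E22, IsLocalDev S D v.1.proj ∧ ∀ᶠ u : unitFuture S U in 𝓝 v,
    P (toGeodesic S U u) (psi (D u.1.proj) (vecOf D u.1))

theorem HoldsNear.eventually {P : GeodesicSpace S U → E21 × E21 → Prop} {v : unitFuture S U}
    (h : HoldsNear S U P v) : ∀ᶠ u in 𝓝 v, HoldsNear S U P u := by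
  obtain ⟨D, hD, hP⟩ := h
  have h1 : Tendsto (fun u : unitFuture S U => u.1.proj) (𝓝 v) (𝓝 v.1.proj) :=
    (tendsto_proj v.1).comp continuous_subtype_val.continuousAt
  filter_upwards [h1.eventually hD.eventually, hP.eventually_nhds] with u h2 h3
  exact ⟨D, h2, h3⟩

/-- Transport along a geodesic: by the local geodesic flow, `HoldsNear` is a closed condition on
the velocities of a geodesic. -/
theorem HoldsNear.of_joined {P : GeodesicSpace S U → E21 × E21 → Prop} (hU : IsOpen U)
    {v w : unitFuture S U} (hj : Joined S (unitFuture S U) v w) (h : HoldsNear S U P v) :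
    HoldsNear S U P w := by
  obtain ⟨v, hv⟩ := v
  obtain ⟨w, hw⟩ := w
  obtain ⟨c, J, hJ, hJc, hc, hu, a, ha, b, hb, h1, h2⟩ := hj
  simp only at h1 h2
  subst h1 h2
  set T : Set ℝ := {s | ∃ hs : s ∈ J, HoldsNear S U P ⟨velocity c s, hu s hs⟩} with hT
  have hvc := continuousOn_velocity hJ hc.1
  have hTo : IsOpen T := by
    rw [isOpen_iff_mem_nhds]
    rintro s ⟨hs, hP⟩
    have h3 := hP.eventually
    rw [nhds_subtype_eq_comap, eventually_comap] at h3
    filter_upwards [(hvc.continuousAt (hJ.mem_nhds hs)).eventually h3, hJ.mem_nhds hs] with r hr hrJ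
    exact ⟨hrJ, hr ⟨_, hu r hrJ⟩ rfl⟩
  have hsub : J ⊆ T := by
    refine hJc.isPreconnected.subset_of_closure_inter_subset hTo ⟨a, ha, ha, h⟩ ?_
    rintro s₀ ⟨hcl, hs₀⟩
    refine ⟨hs₀, ?_⟩
    set q := c s₀ with hq
    obtain ⟨L, hLW⟩ := exists_localSection (S := S) (S.mem_source q)
    obtain ⟨ε, hε, hbox⟩ := L.exists_box hU (w := velocity c s₀) hLW (hu s₀ hs₀).1
    have hcc : ContinuousAt c s₀ := (hc.1.contMDiffAt (hJ.mem_nhds hs₀)).continuousAt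
    obtain ⟨δ, hδ, hball⟩ := Metric.eventually_nhds_iff.1
      ((hcc.eventually (L.isOpen_W.mem_nhds hLW)).and
        (show ∀ᶠ s in 𝓝 s₀, s ∈ J from hJ.mem_nhds hs₀))
    obtain ⟨s₁, hs₁T, hs₁⟩ := Metric.mem_closure_iff.1 hcl (min δ ε) (lt_min hδ hε)
    obtain ⟨hs₁J, D, hD, hP⟩ := hs₁T
    rw [dist_comm] at hs₁
    have hs₁δ := lt_of_lt_of_le hs₁ (min_le_left _ _)
    have hs₁ε : |s₁ - s₀| < ε := lt_of_lt_of_le hs₁ (min_le_right _ _)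
    -- on the ball of radius `δ`, the geodesic is the one of the model
    have hrot : pairOf (S.dev q) (velocity c s₁) =
        (geo (pairOf (S.dev q) (velocity c s₀)) (s₁ - s₀),
          geo' (pairOf (S.dev q) (velocity c s₀)) (s₁ - s₀)) := by
      refine pairOf_velocity (S := S) (U := U) (J := Metric.ball s₀ δ) Metric.isOpen_ball
        (by rw [Real.ball_eq_Ioo]; exact ordConnected_Ioo)
        ⟨hc.1.mono fun r hr => (hball hr).2, fun r hr => hc.2 r (hball hr).2⟩
        (fun r hr => hu r (hball hr).2)
        (fun r hr => isLocalDev_dev (L.W_subset (hball hr).1)) (Metric.mem_ball_self hδ) hs₁δ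
    obtain ⟨A, hA, hDA⟩ := hD.exists_mulVec (L.W_subset (hball hs₁δ).1)
    refine ⟨fun y => A.mulVec (S.dev q y), (isLocalDev_dev (S.mem_source q)).mulVec hA, ?_⟩
    -- the geodesic flow at time `s₁ - s₀`
    set f : TM M → TM M := fun u => L.lift (geo (pairOf (S.dev q) u) (s₁ - s₀),
      geo' (pairOf (S.dev q) u) (s₁ - s₀)) with hf
    have hb₀ := hbox.self_of_nhds
    have hfv : f (velocity c s₀) = velocity c s₁ := by
      rw [hf]; simp only; rw [← hrot]; exact L.lift_pairOf (hball hs₁δ).1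
    have hfc : Tendsto f (𝓝 (velocity c s₀)) (𝓝 (velocity c s₁)) := by
      have hp := (isLocalDev_dev (S := S) (x := (velocity c s₀).proj)
        (S.mem_source q)).continuousAt_pairOf
      have h3 : ContinuousAt (fun p : E22 × E22 => (geo p (s₁ - s₀), geo' p (s₁ - s₀)))
          (pairOf (S.dev q) (velocity c s₀)) := by
        refine Continuous.continuousAt ?_
        unfold geo geo'; fun_prop
      have h4 : ContinuousAt L.lift (geo (pairOf (S.dev q) (velocity c s₀)) (s₁ - s₀),
          geo' (pairOf (S.dev q) (velocity c s₀)) (s₁ - s₀)) :=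
        L.continuousAt_lift (hb₀.2 _ hs₁ε).1
      rw [← hfv]
      exact h4.tendsto.comp (h3.tendsto.comp hp.tendsto)
    have hPn := hP
    rw [nhds_subtype_eq_comap, eventually_comap] at hPn
    have hDA' : ∀ᶠ u : TM M in 𝓝 (velocity c s₁), D u.proj = A.mulVec (S.dev q u.proj) ∧
        vecOf D u = A.mulVec (vecOf (S.dev q) u) := by
      filter_upwards [(tendsto_proj (velocity c s₁)).eventually hDA] with u hu
      exact ⟨hu.1, hu.2 u.2⟩
    rw [nhds_subtype_eq_comap, eventually_comap]
    filter_upwards [hbox, hfc.eventually hPn, hfc.eventually hDA'] with u hub huP huD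
    rintro ⟨u', hu'⟩ rfl
    have hp := (isLocalDev_dev (L.W_subset hub.1)).isUnitFuture hu'
    have hj := L.joined hub.1 hu' hub.2 hs₁ε
    have hfu : f u' ∈ unitFuture S U :=
      L.lift_mem (isUnitFuture_geo hp _) (hub.2 _ hs₁ε).1 (hub.2 _ hs₁ε).2
    have e1 : toGeodesic S U ⟨u', hu'⟩ = toGeodesic S U ⟨f u', hfu⟩ := Quot.sound hj
    have e2 := L.pairOf_lift (p := (geo (pairOf (S.dev q) u') (s₁ - s₀),
      geo' (pairOf (S.dev q) u') (s₁ - s₀))) (isUnitFuture_geo hp _) (hub.2 _ hs₁ε).1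
    have e3 : S.dev q (f u').proj = geo (pairOf (S.dev q) u') (s₁ - s₀) := congrArg Prod.fst e2
    have e4 : vecOf (S.dev q) (f u') = geo' (pairOf (S.dev q) u') (s₁ - s₀) := congrArg Prod.snd e2
    have h6 := huP ⟨f u', hfu⟩ rfl
    simp only at h6 ⊢
    rw [huD.1, huD.2, e3, e4, geo_mulVec, geo'_mulVec, psi_geo] at h6
    rw [e1, vecOf_mulVec _ (isLocalDev_dev (L.W_subset hub.1)).mdifferentiableAt]
    exact h6
  obtain ⟨_, h3⟩ := hsub hb
  exact h3

/-- `HoldsNear` only depends on the geodesic. -/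
theorem HoldsNear.of_toGeodesic_eq {P : GeodesicSpace S U → E21 × E21 → Prop} (hU : IsOpen U)
    {v w : unitFuture S U} (hvw : toGeodesic S U v = toGeodesic S U w) (h : HoldsNear S U P v) :
    HoldsNear S U P w := by
  have key : HoldsNear S U P v ↔ HoldsNear S U P w := by
    clear h
    have := Quot.eqvGen_exact hvw
    clear hvw
    induction this with
    | rel a b hab => exact ⟨HoldsNear.of_joined hU hab, HoldsNear.of_joined hU hab.symm⟩
    | refl a => exact Iff.rfl
    | symm a b _ ih => exact ih.symm
    | trans a b c _ _ ih1 ih2 => exact ih1.trans ih2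
  exact key.1 h

/-! ### The metrics along a curve of time-like vectors -/

/-- The left and right metrics are the squared speeds of the two invariants. The value of a local
developing map differs from that of the chart around `V t` by an isometry, under which the squared
speeds are invariant. -/
theorem metric_eq {V : ℝ → TM M} {t : ℝ}
    (hV : ContMDiffAt 𝓘(ℝ, ℝ) (𝓡 3).tangent ∞ V t) (hVU : ∀ s, V s ∈ unitFuture S U)
    (h : IsLocalDev S D (V t).proj) :
    metricL S V t = mink (deriv (fun s => psiL (D (V s).proj) (vecOf D (V s))) t)
        (deriv (fun s => psiL (D (V s).proj) (vecOf D (V s))) t) ∧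
      metricR S V t = mink (deriv (fun s => psiR (D (V s).proj) (vecOf D (V s))) t)
        (deriv (fun s => psiR (D (V s).proj) (vecOf D (V s))) t) := by
  set q := (V t).proj with hq
  have hdev : IsLocalDev S (S.dev q) (V t).proj := isLocalDev_dev (S.mem_source q)
  have hproj : Tendsto (fun s => (V s).proj) (𝓝 t) (𝓝 q) :=
    (tendsto_proj (V t)).comp hV.continuousAt.tendsto
  set ξ : ℝ → E22 := fun s => S.dev q (V s).proj with hξ
  set η : ℝ → E22 := fun s => vecOf (S.dev q) (V s) with hη
  have hξd : HasDerivAt ξ (deriv ξ t) t :=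
    ((contMDiffAt_iff_contDiffAt.1 (hdev.contMDiffAt_proj.comp t hV)).differentiableAt
      (by simp)).hasDerivAt
  have hηd : HasDerivAt η (deriv η t) t :=
    ((contMDiffAt_iff_contDiffAt.1 (hdev.contMDiffAt_vecOf.comp t hV)).differentiableAt
      (by simp)).hasDerivAt
  have hu : ∀ᶠ s in 𝓝 t, IsUnitFuture (ξ s) (η s) := by
    filter_upwards [hproj.eventually hdev.eventually] with s hs using hs.isUnitFuture (hVU s)
  have hconst : ∀ {x y : ℝ → E22} {x' y' : E22} {k : ℝ}, HasDerivAt x x' t → HasDerivAt y y' t →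
      (∀ᶠ s in 𝓝 t, form (x s) (y s) = k) → form x' (y t) + form (x t) y' = 0 := by
    intro x y x' y' k hx hy hk
    exact (hasDerivAt_form hx hy).unique ((hasDerivAt_const t k).congr_of_eventuallyEq hk)
  have c1 := hconst hξd hξd (hu.mono fun s hs => hs.1)
  have c2 := hconst hξd hηd (hu.mono fun s hs => hs.2.1)
  have c3 := hconst hηd hηd (hu.mono fun s hs => hs.2.2.1)
  obtain ⟨hxx, hxy, hyy, -⟩ := hu.self_of_nhds
  have hxa : form (ξ t) (deriv ξ t) = 0 := by
    rw [form_comm (deriv ξ t)] at c1; linarith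
  have hyb : form (η t) (deriv η t) = 0 := by
    rw [form_comm (deriv η t)] at c3; linarith
  have hk : form (ξ t) (deriv η t) = -form (η t) (deriv ξ t) := by
    rw [form_comm (deriv ξ t)] at c2; linarith
  obtain ⟨A, hA, hDA⟩ := h.exists_mulVec (S.mem_source q)
  have hpsi : HasDerivAt (fun s => psi (D (V s).proj) (vecOf D (V s)))
      (psi (A.mulVec (ξ t)) (A.mulVec (deriv η t)) + psi (A.mulVec (deriv ξ t)) (A.mulVec (η t)))
      t := by
    have h1 := (mulVecCLM A).hasFDerivAt.comp_hasDerivAt t hξd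
    have h2 := (mulVecCLM A).hasFDerivAt.comp_hasDerivAt t hηd
    have h3 := psiCLM.hasDerivAt_of_bilinear (fun _ => h1) (fun _ => h2)
    refine h3.congr_of_eventuallyEq ?_
    filter_upwards [hproj.eventually hDA] with s hs
    rw [hs.1, show vecOf D (V s) = _ from hs.2 (V s).2]
    rfl
  have hL : HasDerivAt (fun s => psiL (D (V s).proj) (vecOf D (V s)))
      (psiL (A.mulVec (deriv ξ t)) (A.mulVec (η t)) + psiL (A.mulVec (ξ t)) (A.mulVec (deriv η t)))
      t := by
    rw [add_comm]; exact hpsi.fst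
  have hR : HasDerivAt (fun s => psiR (D (V s).proj) (vecOf D (V s)))
      (psiR (A.mulVec (deriv ξ t)) (A.mulVec (η t)) + psiR (A.mulVec (ξ t)) (A.mulVec (deriv η t)))
      t := by
    rw [add_comm]; exact hpsi.snd
  rw [hL.deriv, hR.deriv, mink_psiL_add_mulVec hA, mink_psiR_add_mulVec hA]
  exact ⟨form_covDerivL_eq hxx hxy hyy hxa hyb hk, form_covDerivR_eq hxx hxy hyy hxa hyb hk⟩

end

/-! ### Isometric coordinates on the space of geodesics -/

/-- The invariants of a unit time-like vector, as a point of `ℍ² × ℍ²`. -/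
def toHyp (p : E22 × E22) (h : IsUnitFuture p.1 p.2) : HypPlane × HypPlane :=
  (⟨psiL p.1 p.2, psiL_mem h⟩, ⟨psiR p.1 p.2, psiR_mem h⟩)

/-- The embedding of `ℍ² × ℍ²` into `ℝ^{2,1} × ℝ^{2,1}`. -/
def hypVal (z : HypPlane × HypPlane) : E21 × E21 := (z.1.1, z.2.1)

theorem isEmbedding_hypVal : IsEmbedding hypVal :=
  (IsEmbedding.subtypeVal (p := fun z : E21 => mink z z = -1 ∧ 0 < z 0)).prodMap
    (IsEmbedding.subtypeVal (p := fun z : E21 => mink z z = -1 ∧ 0 < z 0))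

section

variable {M : Type*} [TopologicalSpace M] [ChartedSpace (EuclideanSpace ℝ (Fin 3)) M]
variable {S : AdSStructure M} {q : M} {U : Set M} [IsManifold (𝓡 3) ∞ M]

/-- Two vectors close to `w` with the same invariants differ by a small time of the geodesic
flow. -/
theorem exists_small_rotation {w : TM M} (hw : w ∈ unitFuture S U) (hq : w.proj ∈ S.source q)
    {ε : ℝ} (hε : 0 < ε) : ∃ N ∈ 𝓝 w, ∀ v ∈ N, ∀ v' ∈ N, v ∈ unitFuture S U → v' ∈ unitFuture S U →
      psi (S.dev q v.proj) (vecOf (S.dev q) v) = psi (S.dev q v'.proj) (vecOf (S.dev q) v') →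
      ∃ θ, |θ| < ε ∧ pairOf (S.dev q) v' =
        (geo (pairOf (S.dev q) v) θ, geo' (pairOf (S.dev q) v) θ) := by
  set F : (E22 × E22) × (E22 × E22) → ℂ := fun p =>
    ⟨-form p.1.2 p.2.2, form p.1.1 p.2.2⟩ with hF
  have hFc : Continuous F := by
    have : F = fun p => ((-form p.1.2 p.2.2 : ℝ) : ℂ) + ((form p.1.1 p.2.2 : ℝ) : ℂ) * Complex.I := by
      ext p; exact (Complex.mk_eq_add_mul_I _ _)
    rw [this]
    unfold form
    fun_prop
  have hp := (isLocalDev_dev (S := S) hq).continuousAt_pairOf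
  have hu := (isLocalDev_dev (S := S) hq).isUnitFuture hw
  have h1 : F (pairOf (S.dev q) w, pairOf (S.dev q) w) = 1 := by
    rw [hF]
    simp only [pairOf, hu.2.2.1, hu.2.1, neg_neg]
    rfl
  have h2 : ContinuousAt (fun p => Complex.arg (F p)) (pairOf (S.dev q) w, pairOf (S.dev q) w) := by
    -- the argument is continuous at `1`, the value for `v = v' = w`
    refine ContinuousAt.comp (g := Complex.arg) (f := F) ?_ hFc.continuousAt
    rw [h1]
    exact Complex.continuousAt_arg (by simp)
  have h3 : ∀ᶠ p in 𝓝 (pairOf (S.dev q) w, pairOf (S.dev q) w), |Complex.arg (F p)| < ε := by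
    refine h2.abs.eventually_lt_const ?_
    beta_reduce
    rw [h1]; simpa using hε
  rw [nhds_prod_eq] at h3
  obtain ⟨pa, ha, pb, hb, hab⟩ := eventually_prod_iff.1 h3
  refine ⟨_, (hp.eventually (ha.and hb)).and
    ((tendsto_proj w).eventually ((S.isOpen_source q).mem_nhds hq)), ?_⟩
  rintro v ⟨hv, hvq⟩ v' ⟨hv', hvq'⟩ hvU hvU' e
  have hθ := hab hv.1 hv'.2
  have i1 := (isLocalDev_dev (S := S) hvq).isUnitFuture hvU
  have i2 := (isLocalDev_dev (S := S) hvq').isUnitFuture hvU'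
  obtain ⟨e0, e1, e2⟩ := rotate_of_psi_eq i1 i2 e
  refine ⟨_, hθ, ?_⟩
  have hnorm : ‖F (pairOf (S.dev q) v, pairOf (S.dev q) v')‖ = 1 := by
    rw [Complex.norm_def, Complex.normSq_apply, Real.sqrt_eq_one]
    simp only [hF, pairOf]
    linear_combination e0
  have hne : F (pairOf (S.dev q) v, pairOf (S.dev q) v') ≠ 0 := by
    intro h; rw [h] at hnorm; simp at hnorm
  have hcos := Complex.cos_arg hne
  have hsin := Complex.sin_arg (F (pairOf (S.dev q) v, pairOf (S.dev q) v'))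
  rw [hnorm, div_one] at hcos hsin
  refine Prod.ext ?_ ?_
  · simp only [geo, hcos, hsin]; exact e1
  · simp only [geo', hcos, hsin]; exact e2

/-- If the invariants computed in one chart around `w` only depend on the geodesic, then they are
local isometric coordinates on the space of geodesics. -/
theorem locallyIsometricAt_of_psi (hU : IsOpen U) (w : unitFuture S U) (hq : w.1.proj ∈ S.source q)
    {N₀ : Set (TM M)} (hN₀ : N₀ ∈ 𝓝 w.1)
    (hinv : ∀ v v' : unitFuture S U, v.1 ∈ N₀ → v'.1 ∈ N₀ →
      toGeodesic S U v = toGeodesic S U v' →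
      psi (S.dev q v.1.proj) (vecOf (S.dev q) v) = psi (S.dev q v'.1.proj) (vecOf (S.dev q) v')) :
    LocallyIsometricAt S U (toGeodesic S U w) := by
  obtain ⟨L, hLW⟩ := exists_localSection (S := S) hq
  obtain ⟨ε, hε, hbox⟩ := L.exists_box hU hLW w.2.1
  obtain ⟨N₁, hN₁, hrot⟩ := exists_small_rotation w.2 hq hε
  obtain ⟨N, hNsub, hNo, hwN⟩ := _root_.mem_nhds_iff.1 (inter_mem (inter_mem hN₀ hN₁) hbox)
  have hNW : ∀ v ∈ N, v.proj ∈ L.W := fun v hv => (hNsub hv).2.1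
  have hNq : ∀ v ∈ N, v.proj ∈ S.source q := fun v hv => L.W_subset (hNW v hv)
  have huf : ∀ v : unitFuture S U, v.1 ∈ N →
      IsUnitFuture (pairOf (S.dev q) v.1).1 (pairOf (S.dev q) v.1).2 := fun v hv =>
    (isLocalDev_dev (hNq v hv)).isUnitFuture v.2
  -- the chart, on the geodesics with a velocity in `N`
  set Q : Set (GeodesicSpace S U) := toGeodesic S U '' {v | v.1 ∈ N} with hQ
  have hrep : ∀ γ : GeodesicSpace S U, ∃ z : HypPlane × HypPlane, γ ∈ Q →
      ∃ v : unitFuture S U, v.1 ∈ N ∧ toGeodesic S U v = γ ∧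
        hypVal z = psi (S.dev q v.1.proj) (vecOf (S.dev q) v) := by
    intro γ
    by_cases hγ : γ ∈ Q
    · obtain ⟨v, hv, rfl⟩ := hγ
      exact ⟨toHyp _ (huf v hv), fun _ => ⟨v, hv, rfl, rfl⟩⟩
    · exact ⟨toHyp _ (huf w hwN), fun h => absurd h hγ⟩
  choose e he using hrep
  have heN : ∀ v : unitFuture S U, v.1 ∈ N →
      hypVal (e (toGeodesic S U v)) = psi (S.dev q v.1.proj) (vecOf (S.dev q) v) := by
    intro v hv
    obtain ⟨v', hv', h1, h2⟩ := he (toGeodesic S U v) ⟨v, hv, rfl⟩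
    rw [h2]
    exact hinv v' v (hNsub hv').1.1 (hNsub hv).1.1 h1
  have hnear : ∀ v : unitFuture S U, toGeodesic S U v ∈ Q →
      HoldsNear S U (fun γ z => γ ∈ Q ∧ hypVal (e γ) = z) v := by
    rintro v ⟨v', hv', h1⟩
    refine HoldsNear.of_toGeodesic_eq hU h1 ⟨S.dev q, isLocalDev_dev (hNq _ hv'), ?_⟩
    filter_upwards [(hNo.preimage continuous_subtype_val).mem_nhds hv'] with u hu
    exact ⟨⟨u, hu, rfl⟩, heN u hu⟩
  -- `Q` is the image of an open set by a quotient map which is not known to be open: its preimage is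
  -- open by propagation along geodesics
  have hQo : IsOpen Q := by
    refine isQuotientMap_quot_mk.isOpen_preimage.1 (isOpen_iff_mem_nhds.2 fun v hv => ?_)
    obtain ⟨D, hD, hP⟩ := hnear v hv
    exact hP.mono fun u hu => hu.1
  have hcomp : ∀ v : unitFuture S U, toGeodesic S U v ∈ Q →
      ContinuousAt (fun u => e (toGeodesic S U u)) v := by
    intro v hv
    obtain ⟨D, hD, hP⟩ := hnear v hv
    rw [isEmbedding_hypVal.continuousAt_iff]
    have h1 : ContinuousAt (fun u : unitFuture S U => psi (D u.1.proj) (vecOf D u.1)) v :=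
      ContinuousAt.comp (f := Subtype.val) (contMDiffAt_psi hD).continuousAt
        continuous_subtype_val.continuousAt
    exact h1.congr (hP.mono fun u hu => hu.2.symm)
  have hec : ContinuousOn e Q := by
    rw [hQo.continuousOn_iff]
    intro γ hγ
    obtain ⟨v, hv⟩ := Quot.exists_rep γ
    intro T hT
    obtain ⟨T', hT'T, hT'o, hγT⟩ := _root_.mem_nhds_iff.1 hT
    refine mem_map.2 (mem_of_superset (IsOpen.mem_nhds (s := Q ∩ e ⁻¹' T') ?_ ⟨hγ, hγT⟩)
      fun γ' h => hT'T h.2)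
    refine isQuotientMap_quot_mk.isOpen_preimage.1 (isOpen_iff_mem_nhds.2 fun u hu => ?_)
    exact inter_mem ((hQo.preimage continuous_quot_mk).mem_nhds hu.1)
      ((hcomp u hu.1) (hT'o.mem_nhds hu.2))
  have hinj : InjOn e Q := by
    rintro _ ⟨v, hv, rfl⟩ _ ⟨v', hv', rfl⟩ h
    have h1 : psi (S.dev q v.1.proj) (vecOf (S.dev q) v) =
        psi (S.dev q v'.1.proj) (vecOf (S.dev q) v') := by rw [← heN v hv, ← heN v' hv', h]
    obtain ⟨θ, hθ, h2⟩ := hrot v (hNsub hv).1.2 v' (hNsub hv').1.2 v.2 v'.2 h1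
    have h3 := L.joined (hNW v hv) v.2 (hNsub hv).2.2 hθ
    rw [← h2, L.lift_pairOf (hNW v' hv')] at h3
    exact Quot.sound h3
  have : Nonempty (GeodesicSpace S U) := ⟨toGeodesic S U w⟩
  have hopen : IsOpenMap (Q.domRestrict e) := by
    rw [isOpenMap_iff_nhds_le]
    rintro ⟨_, ⟨v, hv, rfl⟩⟩ T hT
    -- `T` contains the image by `e` of a neighbourhood `B` of the geodesic of `v`
    obtain ⟨B, hB, hBT⟩ := (mem_nhds_subtype _ _ _).1 (mem_map.1 hT)
    have hBv : ∀ᶠ u : unitFuture S U in 𝓝 v, toGeodesic S U u ∈ B :=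
      (continuous_quot_mk (r := fun v w : unitFuture S U => Joined S (unitFuture S U) v w)).continuousAt
        hB
    rw [nhds_subtype_eq_comap, eventually_comap] at hBv
    -- lift a neighbourhood of `e γ` to vectors close to `v`, by the local section of `psi`
    set p := pairOf (S.dev q) v.1 with hp
    have hpu : IsUnitFuture p.1 p.2 := huf v hv
    have hev : hypVal (e (toGeodesic S U v)) = psi p.1 p.2 := heN v hv
    have hsc : ContinuousAt (fun z : E21 × E21 => (sectionPt p.1 z, mulL z.1 (sectionPt p.1 z)))
        (psi p.1 p.2) :=
      (continuousAt_sectionPt hpu).prodMk (continuous_mulL.continuousAt.comp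
        (continuousAt_fst.prodMk (continuousAt_sectionPt hpu)))
    have hs0 : (sectionPt p.1 (psi p.1 p.2), mulL (psi p.1 p.2).1 (sectionPt p.1 (psi p.1 p.2))) =
        p := by
      rw [sectionPt_psi hpu, psi, mulL_psiL, hpu.1, hpu.2.1]
      simp
    have hlift : Tendsto (fun z : E21 × E21 => L.lift (sectionPt p.1 z, mulL z.1 (sectionPt p.1 z)))
        (𝓝 (psi p.1 p.2)) (𝓝 v.1) := by
      have h1 := L.continuousAt_lift (p := p) (L.dev_mem _ (hNW v hv))
      have h2 := hsc.tendsto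
      rw [hs0] at h2
      have h3 := h1.tendsto.comp h2
      rwa [hp, L.lift_pairOf (hNW v hv)] at h3
    have hOU : ∀ᶠ z in 𝓝 (psi p.1 p.2), sectionPt p.1 z ∈ L.O ∩ L.σ ⁻¹' U := by
      refine (continuousAt_sectionPt hpu).eventually ((L.smooth.continuousOn.isOpen_inter_preimage
        L.isOpen_O hU).mem_nhds ?_)
      rw [sectionPt_psi hpu]
      have := (hNsub hv).2.2 0 (by simpa using hε)
      rwa [geo_zero] at this
    have hz : ∀ᶠ z in 𝓝 (e (toGeodesic S U v)), hypVal z ∈ {z | (mink z.1 z.1 = -1 →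
        mink z.2 z.2 = -1 → IsUnitFuture (sectionPt p.1 z) (mulL z.1 (sectionPt p.1 z)) ∧
        psi (sectionPt p.1 z) (mulL z.1 (sectionPt p.1 z)) = z) ∧
        sectionPt p.1 z ∈ L.O ∩ L.σ ⁻¹' U ∧
        L.lift (sectionPt p.1 z, mulL z.1 (sectionPt p.1 z)) ∈ N ∧
        ∀ a : unitFuture S U, a.1 = L.lift (sectionPt p.1 z, mulL z.1 (sectionPt p.1 z)) →
          toGeodesic S U a ∈ B} := by
      refine isEmbedding_hypVal.continuous.continuousAt.eventually ?_
      rw [hev]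
      filter_upwards [isUnitFuture_section hpu, hOU, hlift.eventually (hNo.mem_nhds hv),
        hlift.eventually hBv] with z h1 h2 h3 h4
      exact ⟨h1, h2, h3, h4⟩
    filter_upwards [hz] with z hz
    obtain ⟨h1, h2, h3, h4⟩ := hz
    obtain ⟨h5, h6⟩ := h1 z.1.2.1 z.2.2.1
    have h7 := L.lift_mem (U := U) (p := (sectionPt p.1 (hypVal z), mulL (hypVal z).1
      (sectionPt p.1 (hypVal z)))) h5 h2.1 h2.2
    have h8 := L.pairOf_lift (p := (sectionPt p.1 (hypVal z), mulL (hypVal z).1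
      (sectionPt p.1 (hypVal z)))) h5 h2.1
    have h9 := heN ⟨_, h7⟩ h3
    have h10 : e (toGeodesic S U ⟨_, h7⟩) = z := by
      refine isEmbedding_hypVal.injective (h9.trans ?_)
      rw [show S.dev q (L.lift _).proj = _ from congrArg Prod.fst h8,
        show vecOf (S.dev q) (L.lift _) = _ from congrArg Prod.snd h8]
      exact h6
    have h11 : e (toGeodesic S U ⟨_, h7⟩) ∈ T :=
      @hBT ⟨toGeodesic S U ⟨_, h7⟩, ⟨_, h3, rfl⟩⟩ (h4 ⟨_, h7⟩ rfl)
    rwa [h10] at h11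
  refine ⟨OpenPartialHomeomorph.ofContinuousOpenRestrict hinj.toPartialEquiv hec hopen hQo,
    ⟨w, hwN, rfl⟩, ?_, ?_⟩
  · rintro _ ⟨v, hv, rfl⟩
    obtain ⟨D, hD, hP⟩ := hnear v hv
    have hext : ∀ u : unitFuture S U, liftMap S U e u.1 = hypVal (e (toGeodesic S U u)) := fun u =>
      Subtype.val_injective.extend_apply _ _ u
    have h1 : ∀ᶠ u : unitFuture S U in 𝓝 v,
        liftMap S U e u.1 = psi (D u.1.proj) (vecOf D u.1) :=
      hP.mono fun u hu => (hext u).trans hu.2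
    rw [eventually_nhds_subtype_iff (unitFuture S U) v
      (fun u => liftMap S U e u = psi (D u.proj) (vecOf D u))] at h1
    exact (contMDiffAt_psi hD).contMDiffWithinAt.congr_of_eventuallyEq
      (h1.filter_mono (nhdsWithin_mono _ (by rintro _ ⟨u, -, rfl⟩; exact u.2)))
      (h1.self_of_nhdsWithin v.2)
  · intro V t hV hVt
    obtain ⟨D, hD, hP⟩ := hnear (V t) hVt
    have hVc : ContinuousAt V t := IsEmbedding.subtypeVal.continuousAt_iff.2 hV.continuousAt
    have hev := hVc.eventually hP
    obtain ⟨m1, m2⟩ := metric_eq hV (fun s => (V s).2) hD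
    have d1 : (fun s => (e (toGeodesic S U (V s))).1.1) =ᶠ[𝓝 t]
        fun s => psiL (D (V s).1.proj) (vecOf D (V s).1) :=
      hev.mono fun s hs => congrArg Prod.fst hs.2
    have d2 : (fun s => (e (toGeodesic S U (V s))).2.1) =ᶠ[𝓝 t]
        fun s => psiR (D (V s).1.proj) (vecOf D (V s).1) :=
      hev.mono fun s hs => congrArg Prod.snd hs.2
    refine ⟨m1.trans ?_, m2.trans ?_⟩
    · rw [← d1.deriv_eq]; rfl
    · rw [← d2.deriv_eq]; rfl

end

/-! ### A global developing map -/

section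

variable {M : Type*} [TopologicalSpace M] [ChartedSpace (EuclideanSpace ℝ (Fin 3)) M]
variable {S : AdSStructure M} {D : M → E22} {q : M} {U : Set M} [IsManifold (𝓡 3) ∞ M]

omit [IsManifold (𝓡 3) ∞ M] in
/-- The invariants in a developing map defined on all of `U` are functions on `G(U)`. -/
theorem psi_eq_of_toGeodesic_eq (hD : ∀ x ∈ U, IsLocalDev S D x) {v w : unitFuture S U}
    (h : toGeodesic S U v = toGeodesic S U w) :
    psi (D v.1.proj) (vecOf D v) = psi (D w.1.proj) (vecOf D w) :=
  congrArg (Quot.lift (fun v : unitFuture S U => psi (D v.1.proj) (vecOf D v))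
    fun _ _ hj => psi_eq_of_joined subset_rfl (fun _ hu => hD _ hu.1) hj) h

/-- An isometry of the model is determined by its values on an open set of the quadric. -/
theorem mulVec_dev_unique {x : M} (hx : x ∈ S.source q) {A B : Matrix (Fin 4) (Fin 4) ℝ}
    (h : ∀ᶠ y in 𝓝 x, A.mulVec (S.dev q y) = B.mulVec (S.dev q y)) : A = B := by
  have hxt := mem_extChartAt_target (I := 𝓡 3) x
  have hxx := extChartAt_to_inv (I := 𝓡 3) x
  obtain ⟨e, he⟩ := exists_equiv_coneMap (S := S) (q := q) (x := x)
    (p := (extChartAt (𝓡 3) x x, 0)) hxt (by simpa only [hxx] using hx) (by simp)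
  have h1 := (mulVecCLM A).hasFDerivAt.comp (extChartAt (𝓡 3) x x, (0 : ℝ)) he
  have h2 := (mulVecCLM B).hasFDerivAt.comp (extChartAt (𝓡 3) x x, (0 : ℝ)) he
  have hc : Tendsto (fun p : EuclideanSpace ℝ (Fin 3) × ℝ => (extChartAt (𝓡 3) x).symm p.1)
      (𝓝 (extChartAt (𝓡 3) x x, (0 : ℝ))) (𝓝 x) := by
    have h3 := (continuousAt_extChartAt_symm (I := 𝓡 3) x).tendsto
    rw [hxx] at h3
    exact h3.comp continuous_fst.continuousAt.tendsto
  have h4 : (mulVecCLM A ∘ coneMap S q x) =ᶠ[𝓝 (extChartAt (𝓡 3) x x, (0 : ℝ))]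
      (mulVecCLM B ∘ coneMap S q x) := by
    filter_upwards [hc.eventually h] with p hp
    simp only [Function.comp_apply, coneMap, map_smul, mulVecCLM_apply, hp]
  have h5 := h1.unique (h2.congr_of_eventuallyEq h4)
  refine Matrix.toLin'.injective (LinearMap.ext fun Z => ?_)
  have h6 := congrArg (fun T => T (e.symm Z)) h5
  simpa [mulVecCLM_apply] using h6

/-- The group `SO₀(2,2)`, to be endowed with the discrete topology. -/
def DiscreteSO22 : Type := {A : Matrix (Fin 4) (Fin 4) ℝ // A ∈ SO22}

instance : TopologicalSpace DiscreteSO22 := ⊥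

instance : DiscreteTopology DiscreteSO22 := ⟨rfl⟩

instance : Mul DiscreteSO22 := ⟨fun A B => ⟨A.1 * B.1, mul_mem_SO22 A.2 B.2⟩⟩

instance : One DiscreteSO22 := ⟨⟨1, one_mem_SO22⟩⟩

omit [IsManifold (𝓡 3) ∞ M] in
theorem exists_chartChange (S : AdSStructure M) (p q x : M) : ∃ A : DiscreteSO22,
    x ∈ S.source p ∩ S.source q → ∀ᶠ y in 𝓝 x, S.dev q y = A.1.mulVec (S.dev p y) := by
  by_cases h : x ∈ S.source p ∩ S.source q
  · obtain ⟨A, hA, h'⟩ := S.compatible p q x h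
    exact ⟨⟨A, hA⟩, fun _ => h'⟩
  · exact ⟨1, fun h' => absurd h' h⟩

/-- The change of charts from `p` to `q` near `x`. -/
def chartChange (S : AdSStructure M) (p q x : M) : DiscreteSO22 :=
  (exists_chartChange S p q x).choose

omit [IsManifold (𝓡 3) ∞ M] in
theorem chartChange_spec {p q x : M} (h : x ∈ S.source p ∩ S.source q) :
    ∀ᶠ y in 𝓝 x, S.dev q y = (chartChange S p q x).1.mulVec (S.dev p y) :=
  (exists_chartChange S p q x).choose_spec h

theorem chartChange_eq {p q x : M} (h : x ∈ S.source p ∩ S.source q) {A : DiscreteSO22}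
    (hA : ∀ᶠ y in 𝓝 x, S.dev q y = A.1.mulVec (S.dev p y)) : chartChange S p q x = A := by
  refine Subtype.ext (mulVec_dev_unique h.1 ?_)
  filter_upwards [hA, chartChange_spec h] with y h1 h2
  rw [← h1, ← h2]

/-- The bundle of germs of developing maps. Its fiber coordinate over the chart `p` is the `A` in
`A ∘ dev p`. -/
def devBundle (S : AdSStructure M) : FiberBundleCore M M DiscreteSO22 where
  baseSet := S.source
  isOpen_baseSet := S.isOpen_source
  indexAt := id
  mem_baseSet_at := S.mem_source
  coordChange p q x A := A * chartChange S q p x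
  coordChange_self p x hx A := by
    have : chartChange S p p x = 1 :=
      chartChange_eq ⟨hx, hx⟩ (Eventually.of_forall fun y => (Matrix.one_mulVec _).symm)
    rw [this]
    exact Subtype.ext (mul_one A.1)
  continuousOn_coordChange p q := by
    rintro ⟨x, A⟩ ⟨hx, -⟩
    refine ContinuousAt.continuousWithinAt ?_
    have h1 : ∀ᶠ y in 𝓝 x, chartChange S q p y = chartChange S q p x := by
      filter_upwards [(chartChange_spec hx.symm).eventually_nhds,
        ((S.isOpen_source q).inter (S.isOpen_source p)).mem_nhds hx.symm] with y h2 h3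
      exact chartChange_eq h3 h2
    have h2 : ∀ᶠ B in 𝓝 A, B = A := by
      rw [nhds_discrete]; exact rfl
    refine tendsto_const_nhds.congr' ?_
    filter_upwards [h1.prod_nhds h2] with z hz
    rw [hz.1, hz.2]
  coordChange_comp p q r x hx A := by
    have : chartChange S r p x = chartChange S q p x * chartChange S r q x := by
      refine chartChange_eq ⟨hx.2, hx.1.1⟩ ?_
      filter_upwards [chartChange_spec (S := S) ⟨hx.1.2, hx.1.1⟩,
        chartChange_spec (S := S) ⟨hx.2, hx.1.2⟩] with y h1 h2
      rw [h1, h2, Matrix.mulVec_mulVec]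
      rfl
    rw [this]
    exact Subtype.ext (mul_assoc _ _ _)

/-- A simply connected AdS manifold has a global developing map: a section of the covering of germs of
developing maps, that is, a lift of the identity. -/
theorem exists_isLocalDev [SimplyConnectedSpace M] (S : AdSStructure M) :
    ∃ D : M → E22, ∀ x, IsLocalDev S D x := by
  have : LocallyPathConnectedSpace M :=
    ChartedSpace.locallyPathConnectedSpace (EuclideanSpace ℝ (Fin 3)) M
  have hcov : IsCoveringMap (Bundle.TotalSpace.proj : (devBundle S).TotalSpace → M) :=
    FiberBundle.isCoveringMap
  obtain ⟨x₀⟩ : Nonempty M := inferInstance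
  obtain ⟨F, ⟨-, hF⟩, -⟩ := hcov.existsUnique_continuousMap_lifts (ContinuousMap.id M) x₀
    (⟨x₀, (1 : DiscreteSO22)⟩ : (devBundle S).TotalSpace) rfl
  have hproj : ∀ y, (F y).proj = y := fun y => congrFun hF y
  set B : M → DiscreteSO22 := fun y => (F y).2 with hB
  refine ⟨fun y => (B y).1.mulVec (S.dev y y), fun x => ⟨(B x).1, (B x).2, ?_⟩⟩
  have h1 : ContinuousAt (fun y => ((devBundle S).localTriv x (F y)).2) x := by
    have h2 : ContinuousAt ((devBundle S).localTriv x) (F x) := by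
      refine ((devBundle S).localTriv x).toOpenPartialHomeomorph.continuousAt ?_
      rw [FiberBundleCore.mem_localTriv_source, hproj]
      exact S.mem_source x
    exact continuous_snd.continuousAt.comp (h2.comp F.continuous.continuousAt)
  have h3 : ∀ y, ((devBundle S).localTriv x (F y)).2 = B y * chartChange S x y y := by
    intro y
    rw [FiberBundleCore.localTriv_apply]
    change B y * chartChange S x (F y).proj (F y).proj = _
    rw [hproj]
  simp only [h3] at h1
  have h4 : ∀ᶠ y in 𝓝 x, B y * chartChange S x y y = B x * chartChange S x x x := by
    have := h1.tendsto
    rw [nhds_discrete DiscreteSO22] at this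
    exact this.eventually (p := fun A => A = B x * chartChange S x x x) (mem_pure.2 rfl)
  have h5 : chartChange S x x x = 1 := chartChange_eq ⟨S.mem_source x, S.mem_source x⟩
    (Eventually.of_forall fun y => (Matrix.one_mulVec _).symm)
  filter_upwards [h4, (S.isOpen_source x).mem_nhds (S.mem_source x)] with y hy hyx
  have h6 := (chartChange_spec (S := S) (x := y) ⟨hyx, S.mem_source y⟩).self_of_nhds
  rw [h6, Matrix.mulVec_mulVec]
  rw [h5] at hy
  have h7 : (B y).1 * (chartChange S x y y).1 = (B x).1 * 1 := congrArg Subtype.val hy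
  rw [h7, mul_one]

/-! ### Gluing geodesics -/

omit [IsManifold (𝓡 3) ∞ M] in
theorem velocity_congr {c c' : ℝ → M} {t : ℝ} (h : c =ᶠ[𝓝 t] c') : velocity c t = velocity c' t :=
  TM_ext h.self_of_nhds (by
    have := h.mfderiv_eq (I := 𝓘(ℝ, ℝ)) (I' := 𝓡 3)
    exact congrArg (fun T => T (1 : ℝ)) this)

omit [IsManifold (𝓡 3) ∞ M] in
theorem IsGeodesicOn.congr {c c' : ℝ → M} {J : Set ℝ} (hJ : IsOpen J) (hc : IsGeodesicOn S c J)
    (h : EqOn c' c J) : IsGeodesicOn S c' J := by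
  refine ⟨hc.1.congr h, fun t ht => ?_⟩
  have h1 : velocity c' =ᶠ[𝓝 t] velocity c := by
    filter_upwards [hJ.mem_nhds ht] with s hs
    exact velocity_congr (h.eventuallyEq_of_mem (hJ.mem_nhds hs))
  have h2 := hc.2 t ht
  unfold covDeriv at h2 ⊢
  rw [h1.self_of_nhds, ← h2]
  congr 1
  refine Filter.EventuallyEq.deriv_eq ?_
  filter_upwards [h1] with s hs
  rw [hs]

theorem hasMFDerivAt_add_const (t a : ℝ) :
    HasMFDerivAt 𝓘(ℝ, ℝ) 𝓘(ℝ, ℝ) (fun r : ℝ => r + a) t (ContinuousLinearMap.id ℝ ℝ) :=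
  hasMFDerivAt_iff_hasFDerivAt.2 ((hasFDerivAt_id t).add_const a)

omit [IsManifold (𝓡 3) ∞ M] in
theorem velocity_comp_add {c : ℝ → M} {a t : ℝ}
    (hc : MDifferentiableAt 𝓘(ℝ, ℝ) (𝓡 3) c (t + a)) :
    velocity (fun r => c (r + a)) t = velocity c (t + a) := by
  have h := (hc.hasMFDerivAt.comp t (hasMFDerivAt_add_const t a)).mfderiv
  exact TM_ext rfl (congrArg (fun T => T (1 : ℝ)) h)

omit [IsManifold (𝓡 3) ∞ M] in
theorem IsGeodesicOn.comp_add {c : ℝ → M} {J : Set ℝ} (hJ : IsOpen J) (hc : IsGeodesicOn S c J)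
    (a : ℝ) : IsGeodesicOn S (fun r => c (r + a)) ((fun r => r + a) ⁻¹' J) := by
  have hJ' : IsOpen ((fun r : ℝ => r + a) ⁻¹' J) := hJ.preimage (by fun_prop)
  have hv : ∀ r ∈ (fun r : ℝ => r + a) ⁻¹' J,
      velocity (fun r => c (r + a)) r = velocity c (r + a) := fun r hr =>
    velocity_comp_add ((hc.1.contMDiffAt (hJ.mem_nhds hr)).mdifferentiableAt (by simp))
  refine ⟨hc.1.comp (ContDiff.contMDiff (by fun_prop)).contMDiffOn subset_rfl, fun t ht => ?_⟩
  have h2 := hc.2 (t + a) ht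
  unfold covDeriv at h2 ⊢
  rw [hv t ht, ← h2]
  congr 1
  rw [← deriv_comp_add_const]
  refine Filter.EventuallyEq.deriv_eq ?_
  filter_upwards [hJ'.mem_nhds ht] with s hs
  rw [hv s hs]

omit [IsManifold (𝓡 3) ∞ M] in
/-- Uniqueness of geodesics inside a chart. -/
theorem LocalSection.velocity_unique (L : LocalSection S q) {c c' : ℝ → M} {J : Set ℝ}
    (hJ : IsOpen J) (hJc : J.OrdConnected) (hc : IsGeodesicOn S c J) (hc' : IsGeodesicOn S c' J)
    (hu : ∀ t ∈ J, velocity c t ∈ unitFuture S U) (hu' : ∀ t ∈ J, velocity c' t ∈ unitFuture S U)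
    (hW : ∀ t ∈ J, c t ∈ L.W) (hW' : ∀ t ∈ J, c' t ∈ L.W) {s t : ℝ} (hs : s ∈ J) (ht : t ∈ J)
    (e : velocity c s = velocity c' s) : velocity c t = velocity c' t := by
  have h1 := pairOf_velocity hJ hJc hc hu
    (fun t ht => isLocalDev_dev (S := S) (L.W_subset (hW t ht))) hs ht
  have h2 := pairOf_velocity hJ hJc hc' hu'
    (fun t ht => isLocalDev_dev (S := S) (L.W_subset (hW' t ht))) hs ht
  rw [e, ← h2] at h1
  rw [← L.lift_pairOf (w := velocity c t) (hW t ht), h1, L.lift_pairOf (w := velocity c' t) (hW' t ht)]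

/-- Uniqueness of geodesics with a given initial velocity. -/
theorem IsGeodesicOn.velocity_unique [T2Space M] {c c' : ℝ → M} {J : Set ℝ}
    (hJ : IsOpen J) (hJc : J.OrdConnected) (hc : IsGeodesicOn S c J) (hc' : IsGeodesicOn S c' J)
    (hu : ∀ t ∈ J, velocity c t ∈ unitFuture S U) (hu' : ∀ t ∈ J, velocity c' t ∈ unitFuture S U)
    {s : ℝ} (hs : s ∈ J) (e : velocity c s = velocity c' s) :
    ∀ t ∈ J, velocity c t = velocity c' t := by
  -- around a time where the curves meet, agreement at one time implies agreement at all times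
  have hloc : ∀ t ∈ J, c t = c' t → ∃ δ > 0, Metric.ball t δ ⊆ J ∧
      ∀ r ∈ Metric.ball t δ, ∀ r' ∈ Metric.ball t δ, velocity c r = velocity c' r →
        velocity c r' = velocity c' r' := by
    intro t ht e
    obtain ⟨L, hLW⟩ := exists_localSection (S := S) (S.mem_source (c t))
    have h1 : ContinuousAt c t := (hc.1.contMDiffAt (hJ.mem_nhds ht)).continuousAt
    have h2 : ContinuousAt c' t := (hc'.1.contMDiffAt (hJ.mem_nhds ht)).continuousAt
    obtain ⟨δ, hδ, hball⟩ := Metric.eventually_nhds_iff.1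
      (((h1.eventually (L.isOpen_W.mem_nhds hLW)).and
        (h2.eventually (L.isOpen_W.mem_nhds (e ▸ hLW)))).and
        (show ∀ᶠ s in 𝓝 t, s ∈ J from hJ.mem_nhds ht))
    refine ⟨δ, hδ, fun r hr => (hball hr).2, fun r hr r' hr' h => ?_⟩
    exact L.velocity_unique (U := U) Metric.isOpen_ball
      (by rw [Real.ball_eq_Ioo]; exact ordConnected_Ioo)
      ⟨hc.1.mono fun r hr => (hball hr).2, fun r hr => hc.2 r (hball hr).2⟩
      ⟨hc'.1.mono fun r hr => (hball hr).2, fun r hr => hc'.2 r (hball hr).2⟩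
      (fun r hr => hu r (hball hr).2) (fun r hr => hu' r (hball hr).2)
      (fun r hr => (hball hr).1.1) (fun r hr => (hball hr).1.2) hr hr' h
  set T : Set ℝ := {t | t ∈ J ∧ velocity c t = velocity c' t} with hT
  have hTo : IsOpen T := by
    rw [Metric.isOpen_iff]
    rintro t ⟨ht, h⟩
    obtain ⟨δ, hδ, hsub, hd⟩ := hloc t ht (congrArg Bundle.TotalSpace.proj h)
    exact ⟨δ, hδ, fun r hr => ⟨hsub hr, hd t (Metric.mem_ball_self hδ) r hr h⟩⟩
  have hsub : J ⊆ T := by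
    refine hJc.isPreconnected.subset_of_closure_inter_subset hTo ⟨s, hs, hs, e⟩ ?_
    rintro t ⟨hcl, ht⟩
    have h1 : ContinuousAt c t := (hc.1.contMDiffAt (hJ.mem_nhds ht)).continuousAt
    have h2 : ContinuousAt c' t := (hc'.1.contMDiffAt (hJ.mem_nhds ht)).continuousAt
    have hne : (𝓝[T] t).NeBot := mem_closure_iff_nhdsWithin_neBot.1 hcl
    have h3 : c t = c' t := by
      refine tendsto_nhds_unique_of_eventuallyEq (l := 𝓝[T] t) (h1.tendsto.mono_left nhdsWithin_le_nhds)
        (h2.tendsto.mono_left nhdsWithin_le_nhds) ?_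
      filter_upwards [self_mem_nhdsWithin] with r hr
      exact congrArg Bundle.TotalSpace.proj hr.2
    obtain ⟨δ, hδ, hsub, hd⟩ := hloc t ht h3
    obtain ⟨r, hrT, hr⟩ := Metric.mem_closure_iff.1 hcl δ hδ
    exact ⟨ht, hd r (by rwa [Metric.mem_ball, dist_comm]) t (Metric.mem_ball_self hδ) hrT.2⟩
  exact fun t ht => (hsub ht).2

/-- Geodesics through a common velocity can be glued, as they agree where both are defined (`M` is
Hausdorff). -/
theorem Joined.trans [T2Space M] {u v w : TM M} (h₁ : Joined S (unitFuture S U) u v)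
    (h₂ : Joined S (unitFuture S U) v w) : Joined S (unitFuture S U) u w := by
  obtain ⟨c, J, hJ, hJc, hc, hu, s, hs, t, ht, rfl, rfl⟩ := h₁
  obtain ⟨c', J', hJ', hJc', hc', hu', s', hs', t', ht', h1, rfl⟩ := h₂
  -- the second geodesic, translated so that both pass through `v` at time `t`
  set a := s' - t with ha
  set c₂ : ℝ → M := fun r => c' (r + a) with hc₂
  set K : Set ℝ := (fun r => r + a) ⁻¹' J' with hK
  have hKo : IsOpen K := hJ'.preimage (by fun_prop)
  have hKc : K.OrdConnected := hJc'.preimage_mono (fun x y h => by simpa using h)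
  have hg₂ : IsGeodesicOn S c₂ K := hc'.comp_add hJ' a
  have hv₂ : ∀ r ∈ K, velocity c₂ r = velocity c' (r + a) := fun r hr =>
    velocity_comp_add ((hc'.1.contMDiffAt (hJ'.mem_nhds hr)).mdifferentiableAt (by simp))
  have hu₂ : ∀ r ∈ K, velocity c₂ r ∈ unitFuture S U := fun r hr => by
    rw [hv₂ r hr]; exact hu' _ hr
  have htK : t ∈ K := by rw [hK, mem_preimage, ha]; simpa using hs'
  have hagree := IsGeodesicOn.velocity_unique (U := U) (hJ.inter hKo) (hJc.inter hKc)
    ⟨hc.1.mono inter_subset_left, fun r hr => hc.2 r hr.1⟩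
    ⟨hg₂.1.mono inter_subset_right, fun r hr => hg₂.2 r hr.2⟩
    (fun r hr => hu r hr.1) (fun r hr => hu₂ r hr.2) ⟨ht, htK⟩
    (by rw [hv₂ t htK, ← h1, ha]; congr 1; ring)
  classical
  set b : ℝ → M := J.piecewise c c₂ with hb
  have hbJ : EqOn b c J := piecewise_eqOn _ _ _
  have hbK : EqOn b c₂ K := by
    intro r hr
    by_cases hrJ : r ∈ J
    · rw [hbJ hrJ]; exact congrArg Bundle.TotalSpace.proj (hagree r ⟨hrJ, hr⟩)
    · exact piecewise_eq_of_notMem _ _ _ hrJ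
  have hgJ := hc.congr hJ hbJ
  have hgK := hg₂.congr hKo hbK
  have hvJ : ∀ r ∈ J, velocity b r = velocity c r := fun r hr =>
    velocity_congr (hbJ.eventuallyEq_of_mem (hJ.mem_nhds hr))
  have hvK : ∀ r ∈ K, velocity b r = velocity c₂ r := fun r hr =>
    velocity_congr (hbK.eventuallyEq_of_mem (hKo.mem_nhds hr))
  have ht'K : t' - a ∈ K := by rw [hK, mem_preimage]; simpa using ht'
  refine ⟨b, J ∪ K, hJ.union hKo, ?_, ⟨?_, ?_⟩, ?_, s, Or.inl hs, t' - a, Or.inr ht'K, hvJ s hs, ?_⟩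
  · exact (hJc.isPreconnected.union t ht htK hKc.isPreconnected).ordConnected
  · rintro r (hr | hr)
    · exact (hgJ.1.contMDiffAt (hJ.mem_nhds hr)).contMDiffWithinAt
    · exact (hgK.1.contMDiffAt (hKo.mem_nhds hr)).contMDiffWithinAt
  · rintro r (hr | hr)
    · exact hgJ.2 r hr
    · exact hgK.2 r hr
  · rintro r (hr | hr)
    · rw [hvJ r hr]; exact hu r hr
    · rw [hvK r hr]; exact hu₂ r hr
  · rw [hvK _ ht'K, hv₂ _ ht'K, sub_add_cancel]

theorem Joined.refl (hU : IsOpen U) {v : TM M} (hv : v ∈ unitFuture S U) :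
    Joined S (unitFuture S U) v v := by
  obtain ⟨L, hLW⟩ := exists_localSection (S := S) (S.mem_source v.proj)
  obtain ⟨ε, hε, hbox⟩ := L.exists_box hU hLW hv.1
  have h := L.joined hLW hv hbox.self_of_nhds.2 (θ := 0) (by simpa using hε)
  rw [geo_zero, geo'_zero] at h
  rwa [show ((pairOf (S.dev v.proj) v).1, (pairOf (S.dev v.proj) v).2) = pairOf (S.dev v.proj) v
    from rfl, L.lift_pairOf hLW] at h

/-- In a Hausdorff manifold, being joined is an equivalence relation, so that the points of `G(U)` are
its classes. -/
theorem joined_of_toGeodesic_eq [T2Space M] (hU : IsOpen U) {v w : unitFuture S U}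
    (h : toGeodesic S U v = toGeodesic S U w) : Joined S (unitFuture S U) v w := by
  have := Quot.eqvGen_exact h
  clear h
  induction this with
  | rel a b hab => exact hab
  | refl a => exact Joined.refl hU a.2
  | symm a b _ ih => exact ih.symm
  | trans a b c _ _ ih1 ih2 => exact ih1.trans ih2

/-! ### The three cases -/

theorem locallyIsometricAt_of_subset_source (hUo : IsOpen U) (hU : U ⊆ S.source q)
    (w : unitFuture S U) : LocallyIsometricAt S U (toGeodesic S U w) :=
  locallyIsometricAt_of_psi hUo w (hU w.2.1) univ_mem fun _ _ _ _ h =>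
    psi_eq_of_toGeodesic_eq (fun _ hx => isLocalDev_dev (hU hx)) h

theorem locallyIsometricAt_of_simplyConnectedSpace [SimplyConnectedSpace M]
    (w : unitFuture S univ) : LocallyIsometricAt S univ (toGeodesic S univ w) := by
  obtain ⟨D, hD⟩ := exists_isLocalDev S
  have hq := S.mem_source w.1.proj
  obtain ⟨A, hA, hDA⟩ := (hD w.1.proj).exists_mulVec hq
  have hN : ∀ᶠ u : TM M in 𝓝 w.1, (D u.proj = A.mulVec (S.dev w.1.proj u.proj) ∧
      vecOf D u = A.mulVec (vecOf (S.dev w.1.proj) u)) ∧ u.proj ∈ S.source w.1.proj := by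
    filter_upwards [(tendsto_proj w.1).eventually hDA,
      (tendsto_proj w.1).eventually ((S.isOpen_source _).mem_nhds hq)] with u h h'
    exact ⟨⟨h.1, h.2 u.2⟩, h'⟩
  refine locallyIsometricAt_of_psi isOpen_univ w hq hN fun v v' hv hv' h => ?_
  have h1 := psi_eq_of_toGeodesic_eq (fun x _ => hD x) h
  rw [hv.1.1, hv.1.2, hv'.1.1, hv'.1.2] at h1
  exact psi_eq_of_psi_mulVec_eq hA ((isLocalDev_dev hv.2).isUnitFuture v.2)
    ((isLocalDev_dev hv'.2).isUnitFuture v'.2) h1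

theorem NoReturnAt.locallyIsometricAt [T2Space M] {w : unitFuture S univ}
    (hw : NoReturnAt S w.1) : LocallyIsometricAt S univ (toGeodesic S univ w) := by
  have hq := S.mem_source w.1.proj
  have hop : IsOpen (Bundle.TotalSpace.proj ⁻¹' S.source w.1.proj : Set (TM M)) :=
    (S.isOpen_source _).preimage (FiberBundle.continuous_proj _ _)
  obtain ⟨N, hNs, hNo, hwN, hN⟩ := hw _ hop hq
  refine locallyIsometricAt_of_psi isOpen_univ w hq (hNo.mem_nhds hwN) fun v v' hv hv' h => ?_
  -- the geodesic from `v` to `v'` may leave the chart, but by hypothesis some other one does not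
  exact psi_eq_of_joined inter_subset_right (fun u hu => isLocalDev_dev (hNs hu.1))
    (hN v ⟨hv, v.2⟩ v' ⟨hv', v'.2⟩ (joined_of_toGeodesic_eq isOpen_univ h))

end

end AdS

end

theorem lemma3p10 {M : Type*} [TopologicalSpace M] [T2Space M]
    [ChartedSpace (EuclideanSpace ℝ (Fin 3)) M] [IsManifold (𝓡 3) ∞ M]
    (S : AdS.AdSStructure M) :
    (∀ p : M, ∃ U₀ : Set M, IsOpen U₀ ∧ p ∈ U₀ ∧ ∀ U ⊆ U₀, IsOpen U →
      ∀ γ : AdS.GeodesicSpace S U, AdS.LocallyIsometricAt S U γ) ∧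
    (SimplyConnectedSpace M →
      ∀ γ : AdS.GeodesicSpace S univ, AdS.LocallyIsometricAt S univ γ) ∧
    (∀ w : AdS.unitFuture S univ, AdS.NoReturnAt S w →
      AdS.LocallyIsometricAt S univ (AdS.toGeodesic S univ w)) := by
  refine ⟨fun p => ⟨S.source p, S.isOpen_source p, S.mem_source p, fun U hU hUo γ => ?_⟩,
    fun _ γ => ?_, fun _ => AdS.NoReturnAt.locallyIsometricAt⟩
  · obtain ⟨w, rfl⟩ := Quot.exists_rep γ
    exact AdS.locallyIsometricAt_of_subset_source hUo hU w
  · obtain ⟨w, rfl⟩ := Quot.exists_rep γ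
    exact AdS.locallyIsometricAt_of_simplyConnectedSpace w
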